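/- **Setting.** Let $\Omega\subset\mathbb C^n$ be a smoothly bounded domain (a bounded, connected, non-empty open set with $C^\infty$ boundary $b\Omega$), and let $s,q\ge 0$ be integers. Write $z_j=x_j+ix_{j+n}$, $D_k=\partial/\partial x_k$ for $1\le k\le 2n$, and $\gamma_\alpha=|\alpha|!/\alpha!$ for a multi-index $\alpha\in\mathbb Z_{\ge0}^{2n}$. Let $C^\infty_{(0,q)}(\overline\Omega)$ be the space of forms $\phi=\sum_{|J|=q}\phi_J\,d\bar z^J$ ($J$ running over increasing $q$-tuples) whose coefficients are restrictions to $\overline\Omega$ of $C^\infty$ functions on $\mathbb C^n$, and put $$\langle\phi,\psi\rangle_s=\sum_{|J|=q}\ \sum_{|\alpha|\le s}\gamma_\alpha\int_\Omega D^\alpha\phi_J\,\overline{D^\alpha\psi_J}.$$ Let $W^s_{(0,q)}(\Omega)$ be the Hilbert space obtained as the closure (completion) of $C^\infty_{(0,q)}(\overline\Omega)$ with respect to $\langle\cdot,\cdot\rangle_s$. Let $$\bar\partial:W^s_{(0,q)}(\Omega)\to W^s_{(0,q+1)}(\Omega)$$ be the closed, densely defined operator which is the closure of $$\bar\partial\phi=\sum_{|K|=q+1}\sum_{k,J}\varepsilon^K_{kJ}\frac{\partial\phi_J}{\partial\bar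 z_k}\,d\bar z^K,\qquad \phi\in C^\infty_{(0,q)}(\overline\Omega),$$ where $\varepsilon^K_{kJ}$ is the sign of the permutation taking $(k,J)$ to $K$ if $\{k\}\cup J=K$ as sets (with $k\notin J$), and $0$ otherwise. Let $\bar\partial^*$ be the Hilbert space adjoint of this operator. Let $\varrho$ be the signed Euclidean distance to $b\Omega$ (negative in $\Omega$, positive outside $\overline\Omega$), which is $C^\infty$ near $b\Omega$. Let $N=\operatorname{grad}\varrho$, regarded as a first-order differential operator near $b\Omega$, and let $N^s$ be its $s$-fold composition. For a $(0,q+1)$-form $\psi=\sum_K\psi_K\,d\bar z^K$ and a $(0,1)$-form $\omega=\sum_k\omega_k\,d\bar z_k$ let $\psi\lrcorner\omega$ be the $(0,q)$-form with coefficients $$(\psi\lrcorner\omega)_I=\sum_{k,K}\varepsilon^K_{kI}\,\psi_K\,\overline{\omega_k},\qquad |I|=q.$$ **Proposition.** For every $\psi\in C^\infty_{(0,q+1)}(\overline\Omega)$, $$\psi\in\operatorname{dom}\bar\partial^*\iff N^s\bigl(\psi\lrcorner\bar\partial\varrho\bigr)_I=0\ \text{ on } b\Omega\ \text{ for every increasing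 } I \text{ with } |I|=q.$$ -/

import Mathlib

open MeasureTheory
open scoped ContDiff LinearPMap

noncomputable section

namespace DbarSobolev

/-! ### Functions on `ℂⁿ` and their derivatives -/

/-- `ℂⁿ` with its Euclidean norm. -/
abbrev Cn (n : ℕ) : Type := EuclideanSpace ℂ (Fin n)

/-- Indices of the `2n` real coordinates of `ℂⁿ`: `Sum.inl j` stands for `Re z_j` and
`Sum.inr j` for `Im z_j`. -/
abbrev RealIdx (n : ℕ) : Type := Fin n ⊕ Fin n

/-- The unit vector of `ℂⁿ` in the direction of a real coordinate. -/
def dirVec {n : ℕ} : RealIdx n → Cn n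
  | Sum.inl j => EuclideanSpace.single j 1
  | Sum.inr j => EuclideanSpace.single j Complex.I

/-- The partial derivative `D_i f` in the direction of a real coordinate. -/
def partialD {n : ℕ} (i : RealIdx n) (f : Cn n → ℂ) : Cn n → ℂ :=
  fun x => fderiv ℝ f x (dirVec i)

/-- `∂f/∂z̄_k = (1/2)(∂f/∂x_k + i ∂f/∂y_k)`. -/
def wirtingerBar {n : ℕ} (k : Fin n) (f : Cn n → ℂ) : Cn n → ℂ :=
  fun x => (1 / 2 : ℂ) * (partialD (Sum.inl k) f x + Complex.I * partialD (Sum.inr k) f x)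

/-- The space of complex-valued `C^∞` functions on `ℂⁿ`; the functions in `C^∞(Ω̄)` are the
restrictions of these to `Ω̄`. -/
def SmoothFn (n : ℕ) : Submodule ℂ (Cn n → ℂ) where
  carrier := {f | ContDiff ℝ ∞ f}
  add_mem' {f g} (hf : ContDiff ℝ ∞ f) (hg : ContDiff ℝ ∞ g) := hf.add hg
  zero_mem' := (contDiff_const : ContDiff ℝ ∞ fun _ : Cn n => (0 : ℂ))
  smul_mem' c {f} (hf : ContDiff ℝ ∞ f) := hf.const_smul c

theorem contDiff_coe {n : ℕ} (f : SmoothFn n) : ContDiff ℝ ∞ (f : Cn n → ℂ) := f.2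

theorem differentiableAt_coe {n : ℕ} (f : SmoothFn n) (x : Cn n) :
    DifferentiableAt ℝ (f : Cn n → ℂ) x :=
  (contDiff_coe f).differentiable (by simp) x

theorem contDiff_partialD {n : ℕ} (i : RealIdx n) {f : Cn n → ℂ} (hf : ContDiff ℝ ∞ f) :
    ContDiff ℝ ∞ (partialD i f) :=
  (hf.fderiv_right (m := ∞) (by simp)).clm_apply contDiff_const

/-- `D_i` as a linear operator on smooth functions. -/
def smoothD {n : ℕ} (i : RealIdx n) : Module.End ℂ (SmoothFn n) where
  toFun f := ⟨partialD i f, contDiff_partialD i f.2⟩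
  map_add' f g := by
    ext x
    simp [partialD, fderiv_add (differentiableAt_coe f x) (differentiableAt_coe g x)]
  map_smul' c f := by
    ext x
    simp [partialD, fderiv_const_smul (differentiableAt_coe f x) c]

/-- `∂/∂z̄_k` as a linear operator on smooth functions. -/
def smoothWirtingerBar {n : ℕ} (k : Fin n) : Module.End ℂ (SmoothFn n) :=
  (1 / 2 : ℂ) • (smoothD (Sum.inl k) + Complex.I • smoothD (Sum.inr k))

theorem smoothWirtingerBar_coe {n : ℕ} (k : Fin n) (f : SmoothFn n) :
    (smoothWirtingerBar k f : Cn n → ℂ) = wirtingerBar k f := by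
  ext x
  simp [smoothWirtingerBar, wirtingerBar, smoothD, mul_add]

/-- Multi-indices `α` in the `2n` real coordinates with `|α| ≤ s`. -/
abbrev MultiIdx (n s : ℕ) : Type := {α : RealIdx n → ℕ // ∑ i, α i ≤ s}

instance (n s : ℕ) : Finite (MultiIdx n s) := by
  have h : ({α : RealIdx n → ℕ | ∑ i, α i ≤ s}).Finite :=
    (Set.finite_Iic (fun _ : RealIdx n => s)).subset fun α hα i =>
      (Finset.single_le_sum (f := α) (fun _ _ => Nat.zero_le _) (Finset.mem_univ i)).trans hα
  exact h.to_subtype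

instance (n s : ℕ) : Fintype (MultiIdx n s) := Fintype.ofFinite _

/-- `D^α`, the product over the real coordinates of the powers `D_i ^ α_i` (on smooth functions the
order of the factors is immaterial). -/
def smoothDMulti {n : ℕ} (α : RealIdx n → ℕ) : Module.End ℂ (SmoothFn n) :=
  ((List.finRange n).map fun j => smoothD (Sum.inl j) ^ α (Sum.inl j)).prod *
    ((List.finRange n).map fun j => smoothD (Sum.inr j) ^ α (Sum.inr j)).prod

/-- `γ_α = |α|! / α!`. -/
def gammaCoeff {n : ℕ} (α : RealIdx n → ℕ) : ℕ := Nat.multinomial Finset.univ α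

/-! ### Domains -/

/-- A smoothly bounded domain in `ℂⁿ`: bounded, open, connected and non-empty, and near every
boundary point it is the set where a real `C^∞` function with non-vanishing differential at that
point is negative. -/
structure SmoothlyBoundedDomain (n : ℕ) where
  carrier : Set (Cn n)
  isOpen : IsOpen carrier
  isConnected : IsConnected carrier
  isBounded : Bornology.IsBounded carrier
  smooth_boundary : ∀ p ∈ frontier carrier, ∃ U : Set (Cn n), IsOpen U ∧ p ∈ U ∧
    ∃ r : Cn n → ℝ, ContDiffOn ℝ ∞ r U ∧ fderiv ℝ r p ≠ 0 ∧
      ∀ x ∈ U, x ∈ carrier ↔ r x < 0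

open scoped Classical in
/-- The signed Euclidean distance `ϱ` to `bΩ`, negative inside and positive outside. -/
def signedDist {n : ℕ} (Ω : SmoothlyBoundedDomain n) (x : Cn n) : ℝ :=
  if x ∈ Ω.carrier then -Metric.infDist x (frontier Ω.carrier)
  else Metric.infDist x (frontier Ω.carrier)

/-- The vector field `N = grad ϱ` acting on functions. -/
def normalD {n : ℕ} (Ω : SmoothlyBoundedDomain n) (f : Cn n → ℂ) : Cn n → ℂ :=
  fun x => fderiv ℝ f x (gradient (signedDist Ω) x)

/-! ### Forms of type `(0,q)` -/

/-- Increasing `q`-tuples `J` of indices in `{1, …, n}`. -/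
abbrev FormIdx (n q : ℕ) : Type := {J : Fin q → Fin n // StrictMono J}

instance (n q : ℕ) : Fintype (FormIdx n q) := Fintype.ofFinite _

/-- The sign `ε^K_{kJ}` of the permutation taking `(k, J)` to `K` if there is one (it is then
unique, the entries of `K` being distinct), and `0` otherwise. -/
def epsSign {n q : ℕ} (K : FormIdx n (q + 1)) (k : Fin n) (J : FormIdx n q) : ℤ :=
  ∑ σ : Equiv.Perm (Fin (q + 1)),
    if (fun a => (Fin.cons k J.1 : Fin (q + 1) → Fin n) (σ a)) = K.1
      then ((Equiv.Perm.sign σ : ℤˣ) : ℤ) else 0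

/-- A `(0,q)`-form with smooth coefficients, given by its coefficients `φ_J`. -/
abbrev SmoothForm (n q : ℕ) : Type := FormIdx n q → SmoothFn n

/-- `∂̄` on smooth `(0,q)`-forms:
`(∂̄φ)_K = ∑_{k,J} ε^K_{kJ} ∂φ_J/∂z̄_k`. -/
def smoothDbar (n q : ℕ) : SmoothForm n q →ₗ[ℂ] SmoothForm n (q + 1) :=
  LinearMap.pi fun K => ∑ k : Fin n, ∑ J : FormIdx n q,
    (epsSign K k J : ℂ) • (smoothWirtingerBar k ∘ₗ LinearMap.proj J)

/-- The contraction `(ψ ⌟ η)_I = ∑_{k,K} ε^K_{kI} ψ_K η̄_k` of a `(0,q+1)`-form with a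
`(0,1)`-form `η = ∑_k η_k dz̄_k`, both given by their coefficient functions. -/
def contraction {n q : ℕ} (ψ : FormIdx n (q + 1) → Cn n → ℂ) (η : Fin n → Cn n → ℂ)
    (I : FormIdx n q) : Cn n → ℂ :=
  fun x => ∑ k : Fin n, ∑ K : FormIdx n (q + 1),
    (epsSign K k I : ℂ) * ψ K x * (starRingEnd ℂ) (η k x)

/-- The coefficients `∂ϱ/∂z̄_k` of `∂̄ϱ`. -/
def dbarSignedDist {n : ℕ} (Ω : SmoothlyBoundedDomain n) (k : Fin n) : Cn n → ℂ :=
  wirtingerBar k fun x => (signedDist Ω x : ℂ)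

/-! ### The Sobolev space of forms -/

theorem memLp_smooth {n : ℕ} (Ω : SmoothlyBoundedDomain n) (f : SmoothFn n) :
    MemLp (f : Cn n → ℂ) 2 (volume.restrict Ω.carrier) := by
  have hc : Continuous (f : Cn n → ℂ) := (contDiff_coe f).continuous
  have hK : IsCompact (closure Ω.carrier) := Ω.isBounded.isCompact_closure
  obtain ⟨C, hC⟩ := hK.exists_bound_of_continuousOn hc.continuousOn
  have : IsFiniteMeasure (volume.restrict Ω.carrier) :=
    ⟨by rw [Measure.restrict_apply_univ]; exact Ω.isBounded.measure_lt_top⟩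
  refine MemLp.of_bound hc.aestronglyMeasurable C ?_
  filter_upwards [ae_restrict_mem Ω.isOpen.measurableSet] with x hx using
    hC x (subset_closure hx)

/-- The class in `L²(Ω)` of a smooth function. -/
def toL2 {n : ℕ} (Ω : SmoothlyBoundedDomain n) :
    SmoothFn n →ₗ[ℂ] Lp ℂ 2 (volume.restrict Ω.carrier) where
  toFun f := (memLp_smooth Ω f).toLp _
  map_add' f g := MemLp.toLp_add (memLp_smooth Ω f) (memLp_smooth Ω g)
  map_smul' c f := MemLp.toLp_const_smul c (memLp_smooth Ω f)

/-- The Hilbert sum of copies of `L²(Ω)` that holds all derivatives of order at most `s` of all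
coefficients of a `(0,q)`-form. -/
abbrev JetSpace {n : ℕ} (Ω : SmoothlyBoundedDomain n) (s q : ℕ) : Type :=
  PiLp 2 fun _ : FormIdx n q × MultiIdx n s => Lp ℂ 2 (volume.restrict Ω.carrier)

/-- `φ ↦ (√γ_α D^α φ_J)_{J, α}`; by `inner_jet` below it carries the Sobolev inner product
`⟨·,·⟩_s` to the inner product of the Hilbert sum. -/
def jet {n : ℕ} (Ω : SmoothlyBoundedDomain n) (s q : ℕ) :
    SmoothForm n q →ₗ[ℂ] JetSpace Ω s q :=
  (WithLp.linearEquiv 2 ℂ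
    (FormIdx n q × MultiIdx n s → Lp ℂ 2 (volume.restrict Ω.carrier))).symm.toLinearMap ∘ₗ
    LinearMap.pi fun p =>
      ((Real.sqrt (gammaCoeff p.2.1) : ℝ) : ℂ) •
        (toL2 Ω ∘ₗ smoothDMulti p.2.1 ∘ₗ LinearMap.proj p.1)

/-- The inner product induced on smooth forms is
`⟨φ,ψ⟩_s = ∑_J ∑_{|α| ≤ s} γ_α ∫_Ω D^α φ_J \overline{D^α ψ_J}`
(inner products being conjugate-linear in the first argument in Mathlib). -/
theorem inner_jet {n : ℕ} (Ω : SmoothlyBoundedDomain n) (s q : ℕ) (φ ψ : SmoothForm n q) :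
    inner ℂ (jet Ω s q ψ) (jet Ω s q φ) =
      ∑ J : FormIdx n q, ∑ α : MultiIdx n s, (gammaCoeff α.1 : ℂ) *
        ∫ x in Ω.carrier, (smoothDMulti α.1 (φ J) : Cn n → ℂ) x *
          (starRingEnd ℂ) ((smoothDMulti α.1 (ψ J) : Cn n → ℂ) x) := by
  rw [PiLp.inner_apply, Fintype.sum_prod_type]
  refine Finset.sum_congr rfl fun J _ => Finset.sum_congr rfl fun α _ => ?_
  have h : ∀ χ : SmoothForm n q, jet Ω s q χ (J, α) =
      ((Real.sqrt (gammaCoeff α.1) : ℝ) : ℂ) • toL2 Ω (smoothDMulti α.1 (χ J)) :=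
    fun χ => rfl
  rw [h, h, inner_smul_left, inner_smul_right, ← mul_assoc, Complex.conj_ofReal,
    ← Complex.ofReal_mul, Real.mul_self_sqrt (Nat.cast_nonneg _), L2.inner_def]
  congr 1
  refine integral_congr_ae ?_
  filter_upwards [(memLp_smooth Ω (smoothDMulti α.1 (φ J))).coeFn_toLp,
    (memLp_smooth Ω (smoothDMulti α.1 (ψ J))).coeFn_toLp] with x h1 h2
  simp only [toL2, LinearMap.coe_mk, AddHom.coe_mk, h1, h2, RCLike.inner_apply]

/-- `W^s_{(0,q)}(Ω)`: the closure of the space of forms smooth up to the boundary with respect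
to the Sobolev inner product. -/
abbrev Sobolev {n : ℕ} (Ω : SmoothlyBoundedDomain n) (s q : ℕ) :
    Submodule ℂ (JetSpace Ω s q) :=
  (LinearMap.range (jet Ω s q)).topologicalClosure

/-- The element of `W^s_{(0,q)}(Ω)` given by a form that is smooth up to the boundary. -/
def toSobolev {n : ℕ} (Ω : SmoothlyBoundedDomain n) (s q : ℕ) :
    SmoothForm n q →ₗ[ℂ] Sobolev Ω s q :=
  (jet Ω s q).codRestrict _ fun φ =>
    Submodule.le_topologicalClosure _ (LinearMap.mem_range_self _ φ)

/-! ### The operator `∂̄` -/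

/-- The graph of `∂̄` on forms that are smooth up to the boundary. -/
def dbarGraph {n : ℕ} (Ω : SmoothlyBoundedDomain n) (s q : ℕ) :
    Submodule ℂ (Sobolev Ω s q × Sobolev Ω s (q + 1)) :=
  LinearMap.range ((toSobolev Ω s q).prod (toSobolev Ω s (q + 1) ∘ₗ smoothDbar n q))

/-- The smooth functions that vanish on `Ω`. -/
def vanishing {n : ℕ} (Ω : SmoothlyBoundedDomain n) : Submodule ℂ (SmoothFn n) where
  carrier := {f | ∀ x ∈ Ω.carrier, (f : Cn n → ℂ) x = 0}
  add_mem' hf hg x hx := by simp [hf x hx, hg x hx]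
  zero_mem' x _ := rfl
  smul_mem' c f hf x hx := by simp [hf x hx]

theorem toL2_eq_zero_iff {n : ℕ} (Ω : SmoothlyBoundedDomain n) (f : SmoothFn n) :
    toL2 Ω f = 0 ↔ f ∈ vanishing Ω := by
  have h1 : toL2 Ω f = 0 ↔ (f : Cn n → ℂ) =ᵐ[volume.restrict Ω.carrier] 0 :=
    (MemLp.toLp_eq_toLp_iff (memLp_smooth Ω f) MemLp.zero)
  rw [h1]
  constructor
  · intro h
    exact Measure.eqOn_open_of_ae_eq h Ω.isOpen (contDiff_coe f).continuous.continuousOn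
      continuousOn_const
  · intro h
    filter_upwards [ae_restrict_mem Ω.isOpen.measurableSet] with x hx using h x hx

theorem smoothD_vanishing {n : ℕ} (Ω : SmoothlyBoundedDomain n) (i : RealIdx n) :
    vanishing Ω ≤ (vanishing Ω).comap (smoothD i) := by
  intro f hf x hx
  have h : (f : Cn n → ℂ) =ᶠ[nhds x] fun _ => 0 :=
    Filter.eventually_of_mem (Ω.isOpen.mem_nhds hx) hf
  simp [smoothD, partialD, h.fderiv_eq]

theorem smoothDMulti_vanishing {n : ℕ} (Ω : SmoothlyBoundedDomain n) (α : RealIdx n → ℕ) :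
    vanishing Ω ≤ (vanishing Ω).comap (smoothDMulti α) := by
  have hpow : ∀ (i : RealIdx n) (m : ℕ), ∀ f ∈ vanishing Ω, (smoothD i ^ m) f ∈ vanishing Ω := by
    intro i m
    induction m with
    | zero => intro f hf; simpa using hf
    | succ m ih => intro f hf; rw [pow_succ]; exact ih _ (smoothD_vanishing Ω i hf)
  have hlist : ∀ (c : Fin n → RealIdx n) (l : List (Fin n)), ∀ f ∈ vanishing Ω,
      ((l.map fun j => smoothD (c j) ^ α (c j)).prod) f ∈ vanishing Ω := by
    intro c l
    induction l with
    | nil => intro f hf; simpa using hf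
    | cons j l ih => intro f hf; rw [List.map_cons, List.prod_cons]; exact hpow _ _ _ (ih f hf)
  intro f hf
  exact hlist Sum.inl _ _ (hlist Sum.inr _ f hf)

theorem toSobolev_eq_zero_iff {n : ℕ} (Ω : SmoothlyBoundedDomain n) (s q : ℕ)
    (φ : SmoothForm n q) : toSobolev Ω s q φ = 0 ↔ ∀ J, φ J ∈ vanishing Ω := by
  have key : toSobolev Ω s q φ = 0 ↔ jet Ω s q φ = 0 := Subtype.ext_iff
  have comp : ∀ p : FormIdx n q × MultiIdx n s, jet Ω s q φ p =
      ((Real.sqrt (gammaCoeff p.2.1) : ℝ) : ℂ) • toL2 Ω (smoothDMulti p.2.1 (φ p.1)) :=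
    fun p => rfl
  rw [key]
  constructor
  · intro h J
    have h0 := comp (J, ⟨fun _ => 0, by simp⟩)
    rw [h] at h0
    rw [← toL2_eq_zero_iff]
    simpa [gammaCoeff, Nat.multinomial, smoothDMulti] using h0.symm
  · intro h
    refine PiLp.ext fun p => ?_
    rw [comp, (toL2_eq_zero_iff Ω _).2 (smoothDMulti_vanishing Ω _ (h p.1)), smul_zero]
    rfl

/-- `∂̄` is well defined on the classes of smooth forms. -/
theorem dbarGraph_functional {n : ℕ} (Ω : SmoothlyBoundedDomain n) (s q : ℕ)
    (x : Sobolev Ω s q × Sobolev Ω s (q + 1)) (hx : x ∈ dbarGraph Ω s q) (h0 : x.1 = 0) :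
    x.2 = 0 := by
  obtain ⟨φ, rfl⟩ := hx
  have hφ := (toSobolev_eq_zero_iff Ω s q φ).1 h0
  refine (toSobolev_eq_zero_iff Ω s (q + 1) _).2 fun K => ?_
  simp only [smoothDbar, LinearMap.pi_apply, LinearMap.sum_apply, LinearMap.smul_apply,
    LinearMap.comp_apply, LinearMap.proj_apply]
  refine Submodule.sum_mem _ fun k _ => Submodule.sum_mem _ fun J _ =>
    Submodule.smul_mem _ _ ?_
  exact Submodule.smul_mem _ _ (Submodule.add_mem _ (smoothD_vanishing Ω _ (hφ J))
    (Submodule.smul_mem _ _ (smoothD_vanishing Ω _ (hφ J))))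

/-- `∂̄` on smooth forms as an unbounded operator in the Sobolev spaces. -/
def dbarSmooth {n : ℕ} (Ω : SmoothlyBoundedDomain n) (s q : ℕ) :
    Sobolev Ω s q →ₗ.[ℂ] Sobolev Ω s (q + 1) :=
  (dbarGraph Ω s q).toLinearPMap

theorem dbarSmooth_graph {n : ℕ} (Ω : SmoothlyBoundedDomain n) (s q : ℕ) :
    (dbarSmooth Ω s q).graph = dbarGraph Ω s q :=
  Submodule.toLinearPMap_graph_eq _ (dbarGraph_functional Ω s q)

/-- The closed, densely defined operator `∂̄ : W^s_{(0,q)}(Ω) → W^s_{(0,q+1)}(Ω)`. -/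
def dbar {n : ℕ} (Ω : SmoothlyBoundedDomain n) (s q : ℕ) :
    Sobolev Ω s q →ₗ.[ℂ] Sobolev Ω s (q + 1) :=
  (dbarSmooth Ω s q).closure

/-- The `W^s(Ω)`-Hilbert space adjoint `∂̄*` of `∂̄`. -/
def dbarAdjoint {n : ℕ} (Ω : SmoothlyBoundedDomain n) (s q : ℕ) :
    Sobolev Ω s (q + 1) →ₗ.[ℂ] Sobolev Ω s q :=
  (dbar Ω s q)†

end DbarSobolev

end

/-!
The field `N = grad ϱ` satisfies `N N_j = 0`, because `|grad ϱ| = 1` and the Hessian of `ϱ` is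
symmetric. Hence near the boundary `N^s` is `∑ N_{j₁} ⋯ N_{j_s} D_{j₁} ⋯ D_{j_s}`, and
`N^s (ψ ⌟ ∂̄ϱ) = (N^s ψ) ⌟ ∂̄ϱ`.

The operators `D_i - N_i N` are tangential. Integrating them by parts, with
`∑_{|α| = s} γ_α N^{2α} = |N|^{2s} = 1`, one gets
`⟨D_i φ, g⟩_s ≡ ∫_Ω N_i \overline{N^s g} N^{s+1} φ` modulo functionals of `φ` that are bounded in
the `W^s` norm, and therefore
`⟨∂̄φ, ψ⟩_s ≡ ∑_I ∫_Ω \overline{(N^s (ψ ⌟ ∂̄ϱ))_I} N^{s+1} φ_I`.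

So everything depends on the boundedness of `φ ↦ ∫_Ω h N^{s+1} φ`. If `h` vanishes on the boundary,
one more integration by parts bounds it. Conversely, test it on `φ = m^{-s} e^{mϱ} b`: the `W^s`
norms of these functions tend to `0`, while the functional tends to the integral of `h b` over the
boundary. This forces `h` to vanish there.
-/

noncomputable section

namespace DbarSobolev

/-! ### The signed distance near a smooth hypersurface -/

section InverseFunction

open Topology Filter

variable {𝕜 E F : Type*} [RCLike 𝕜] [NormedAddCommGroup E] [NormedSpace 𝕜 E] [CompleteSpace E]
  [NormedAddCommGroup F] [NormedSpace 𝕜 F]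

theorem exists_local_inverse_contDiffAt {m : WithTop ℕ∞} (hm : 1 ≤ m) {f : E → F} {f' : E ≃L[𝕜] F}
    {a : E} (hf : ∀ᶠ w in 𝓝 a, ContDiffAt 𝕜 m f w) (hf' : HasFDerivAt f (f' : E →L[𝕜] F) a) :
    ∃ g : F → E, (∀ᶠ w in 𝓝 a, g (f w) = w) ∧
      ∀ᶠ z in 𝓝 (f a), ContDiffAt 𝕜 m g z ∧ f (g z) = z := by
  have ha : ContDiffAt 𝕜 m f a := hf.self_of_nhds
  have hm0 : m ≠ 0 := (zero_lt_one.trans_le hm).ne'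
  set H := ha.toOpenPartialHomeomorph f hf' hm0
  have haH : a ∈ H.source := ha.mem_toOpenPartialHomeomorph_source hf' hm0
  have hinv : ∀ᶠ w in 𝓝 a, ∃ B : E ≃L[𝕜] F, (B : E →L[𝕜] F) = fderiv 𝕜 f w :=
    (ha.fderiv_right (m := 0) (by simpa using hm)).continuousAt.eventually
      (ContinuousLinearEquiv.isOpen.eventually_mem ⟨f', hf'.fderiv.symm⟩)
  have hsymm : Tendsto H.symm (𝓝 (f a)) (𝓝 a) := H.tendsto_symm haH
  refine ⟨H.symm, H.eventually_left_inverse haH, ?_⟩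
  filter_upwards [hsymm.eventually (hf.and hinv), H.open_target.eventually_mem (H.map_source haH)]
    with z ⟨hz, B, hB⟩ hzT
  refine ⟨H.contDiffAt_symm (f₀' := B) hzT ?_ hz, H.right_inv hzT⟩
  rw [hB]
  exact (hz.differentiableAt hm0).hasFDerivAt

end InverseFunction

section UnitNormal

open Topology Filter

variable {E : Type*} [NormedAddCommGroup E] [InnerProductSpace ℝ E] [CompleteSpace E]
  {ρ : E → ℝ} {y : E}

/-- The unit normal to the level sets of `ρ`, in the direction of increasing `ρ`. Its value at a
critical point of `ρ` is the junk value `0`. -/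
def unitNormal (ρ : E → ℝ) (y : E) : E := ‖gradient ρ y‖⁻¹ • gradient ρ y

theorem gradient_ne_zero (h : fderiv ℝ ρ y ≠ 0) : gradient ρ y ≠ 0 := by
  simpa [gradient] using h

theorem norm_unitNormal (h : fderiv ℝ ρ y ≠ 0) : ‖unitNormal ρ y‖ = 1 :=
  norm_smul_inv_norm (𝕜 := ℝ) (gradient_ne_zero h)

theorem inner_gradient (ρ : E → ℝ) (y v : E) : inner ℝ (gradient ρ y) v = fderiv ℝ ρ y v := by
  simp [gradient]

theorem inner_unitNormal (ρ : E → ℝ) (y v : E) :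
    inner ℝ (unitNormal ρ y) v = ‖gradient ρ y‖⁻¹ * fderiv ℝ ρ y v := by
  rw [unitNormal, real_inner_smul_left, inner_gradient]

theorem fderiv_unitNormal (ρ : E → ℝ) (y : E) :
    fderiv ℝ ρ y (unitNormal ρ y) = ‖gradient ρ y‖ := by
  rw [← inner_gradient, unitNormal, real_inner_smul_right, real_inner_self_eq_norm_mul_norm,
    ← mul_assoc, inv_mul_mul_self]

theorem contDiffAt_gradient (h : ContDiffAt ℝ ∞ ρ y) : ContDiffAt ℝ ∞ (gradient ρ) y :=
  (InnerProductSpace.toDual ℝ E).symm.contDiff.contDiffAt.comp y (h.fderiv_right (by simp))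

theorem contDiffAt_unitNormal (h : ContDiffAt ℝ ∞ ρ y) (h0 : fderiv ℝ ρ y ≠ 0) :
    ContDiffAt ℝ ∞ (unitNormal ρ) y :=
  (((contDiffAt_gradient h).norm ℝ (gradient_ne_zero h0)).inv
    (norm_ne_zero_iff.2 (gradient_ne_zero h0))).smul (contDiffAt_gradient h)

theorem inner_unitNormal_fderiv_unitNormal (h : ContDiffAt ℝ ∞ ρ y) (h0 : fderiv ℝ ρ y ≠ 0)
    (v : E) : inner ℝ (unitNormal ρ y) (fderiv ℝ (unitNormal ρ) y v) = 0 := by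
  have hnorm : ∀ᶠ z in 𝓝 y, ‖unitNormal ρ z‖ ^ 2 = 1 := by
    filter_upwards [(h.fderiv_right (m := 0) (by simp)).continuousAt.eventually_ne h0] with z hz
    rw [norm_unitNormal hz, one_pow]
  have hd : DifferentiableAt ℝ (unitNormal ρ) y :=
    (contDiffAt_unitNormal h h0).differentiableAt (by simp)
  have hderiv := hd.hasFDerivAt.norm_sq.unique
    ((hasFDerivAt_const (1 : ℝ) y).congr_of_eventuallyEq hnorm)
  simpa using DFunLike.congr_fun hderiv v

/-- Normal coordinates: `(y, t) ↦ (y + t n(y), ρ(y))`, where `n` is the unit normal to the level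
sets of `ρ`. -/
def normalMap (ρ : E → ℝ) (w : E × ℝ) : E × ℝ := (w.1 + w.2 • unitNormal ρ w.1, ρ w.1)

theorem contDiffAt_normalMap {w : E × ℝ} (h : ContDiffAt ℝ ∞ ρ w.1) (h0 : fderiv ℝ ρ w.1 ≠ 0) :
    ContDiffAt ℝ ∞ (normalMap ρ) w :=
  (contDiffAt_fst.add
    (contDiffAt_snd.smul ((contDiffAt_unitNormal h h0).comp w contDiffAt_fst))).prodMk
    (h.comp w contDiffAt_fst)

/-- The derivative of `normalMap` at a point `(y, 0)`. -/
def normalMapDeriv (ρ : E → ℝ) (y : E) (h0 : fderiv ℝ ρ y ≠ 0) : (E × ℝ) ≃L[ℝ] E × ℝ :=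
  ContinuousLinearEquiv.equivOfInverse
    ((ContinuousLinearMap.fst ℝ E ℝ +
      (ContinuousLinearMap.snd ℝ E ℝ).smulRight (unitNormal ρ y)).prod
        (fderiv ℝ ρ y ∘L ContinuousLinearMap.fst ℝ E ℝ))
    ((ContinuousLinearMap.fst ℝ E ℝ - (‖gradient ρ y‖⁻¹ •
        (fderiv ℝ ρ y ∘L ContinuousLinearMap.fst ℝ E ℝ - ContinuousLinearMap.snd ℝ E ℝ)).smulRight
          (unitNormal ρ y)).prod
      (‖gradient ρ y‖⁻¹ •
        (fderiv ℝ ρ y ∘L ContinuousLinearMap.fst ℝ E ℝ - ContinuousLinearMap.snd ℝ E ℝ)))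
    (fun v => by
      have := norm_ne_zero_iff.2 (gradient_ne_zero h0)
      ext <;> simp [fderiv_unitNormal, mul_left_comm _ v.2, this])
    (fun v => by ext <;> simp [fderiv_unitNormal, mul_right_comm, gradient_ne_zero h0])

theorem hasFDerivAt_normalMap (h : ContDiffAt ℝ ∞ ρ y) (h0 : fderiv ℝ ρ y ≠ 0) :
    HasFDerivAt (normalMap ρ) (normalMapDeriv ρ y h0 : E × ℝ →L[ℝ] E × ℝ) (y, 0) := by
  have hn : DifferentiableAt ℝ (unitNormal ρ) y :=
    (contDiffAt_unitNormal h h0).differentiableAt (by simp)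
  have hρ : DifferentiableAt ℝ ρ y := h.differentiableAt (by simp)
  have hderiv := ((hasFDerivAt_fst (𝕜 := ℝ) (p := (y, (0 : ℝ)))).add
    ((hasFDerivAt_snd (𝕜 := ℝ) (p := (y, (0 : ℝ)))).smul
      (hn.hasFDerivAt.comp (y, (0 : ℝ)) hasFDerivAt_fst))).prodMk
        (hρ.hasFDerivAt.comp (y, (0 : ℝ)) hasFDerivAt_fst)
  refine hderiv.congr_fderiv ?_
  ext v <;> simp [normalMapDeriv]

theorem exists_normal_coordinates (h : ∀ᶠ z in 𝓝 y, ContDiffAt ℝ ∞ ρ z) (h0 : fderiv ℝ ρ y ≠ 0)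
    (hy : ρ y = 0) :
    ∃ (π : E → E) (t : E → ℝ), Tendsto π (𝓝 y) (𝓝 y) ∧
      (∀ᶠ x in 𝓝 y, ContDiffAt ℝ ∞ π x ∧ ContDiffAt ℝ ∞ t x ∧
        π x + t x • unitNormal ρ (π x) = x ∧ ρ (π x) = 0) ∧
      ∀ᶠ w : E × ℝ in 𝓝 (y, 0), ρ w.1 = 0 → t (w.1 + w.2 • unitNormal ρ w.1) = w.2 := by
  have hne : ∀ᶠ z in 𝓝 y, fderiv ℝ ρ z ≠ 0 :=
    (h.self_of_nhds.fderiv_right (m := 0) (by simp)).continuousAt.eventually_ne h0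
  have hsmooth : ∀ᶠ w in 𝓝 (y, (0 : ℝ)), ContDiffAt ℝ ∞ (normalMap ρ) w :=
    (continuousAt_fst (p := (y, (0 : ℝ)))).eventually (h.and hne) |>.mono
      fun w hw => contDiffAt_normalMap hw.1 hw.2
  obtain ⟨g, hgl, hgr⟩ := exists_local_inverse_contDiffAt (by simp) hsmooth
    (hasFDerivAt_normalMap h.self_of_nhds h0)
  have hfix : normalMap ρ (y, 0) = (y, 0) := by simp [normalMap, hy]
  have hgy : g (y, 0) = (y, 0) := by simpa only [hfix] using hgl.self_of_nhds
  rw [hfix] at hgr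
  have hι : Tendsto (fun x : E => (x, (0 : ℝ))) (𝓝 y) (𝓝 (y, 0)) :=
    (Continuous.prodMk_left (0 : ℝ)).continuousAt
  have hπ : Tendsto (fun x => (g (x, 0)).1) (𝓝 y) (𝓝 y) := by
    have hg := (continuousAt_fst.comp hgr.self_of_nhds.1.continuousAt).tendsto.comp hι
    simpa only [Function.comp_def, hgy] using hg
  refine ⟨fun x => (g (x, 0)).1, fun x => (g (x, 0)).2, hπ,
    (hι.eventually hgr).mono fun x ⟨hx, hxg⟩ => ?_, hgl.mono fun w hw hρw => ?_⟩
  · have hgx : ContDiffAt ℝ ∞ (fun x : E => g (x, (0 : ℝ))) x :=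
      hx.comp x (contDiffAt_id.prodMk contDiffAt_const)
    rw [normalMap, Prod.mk.injEq] at hxg
    exact ⟨contDiffAt_fst.comp x hgx, contDiffAt_snd.comp x hgx, hxg⟩
  · rw [normalMap, hρw] at hw
    exact congrArg Prod.snd hw

theorem gradient_eq_unitNormal {π : E → E} {t : E → ℝ} {x : E} (hπ : DifferentiableAt ℝ π x)
    (ht : DifferentiableAt ℝ t x) (h : ContDiffAt ℝ ∞ ρ (π x)) (h0 : fderiv ℝ ρ (π x) ≠ 0)
    (hx : ∀ᶠ z in 𝓝 x, π z + t z • unitNormal ρ (π z) = z) (hlevel : ∀ᶠ z in 𝓝 x, ρ (π z) = 0) :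
    gradient t x = unitNormal ρ (π x) := by
  have hn : DifferentiableAt ℝ (unitNormal ρ) (π x) :=
    (contDiffAt_unitNormal h h0).differentiableAt (by simp)
  have hρ : DifferentiableAt ℝ ρ (π x) := h.differentiableAt (by simp)
  have hdx := (hπ.hasFDerivAt.add (ht.hasFDerivAt.smul (hn.hasFDerivAt.comp x hπ.hasFDerivAt)))
    |>.unique ((hasFDerivAt_id x).congr_of_eventuallyEq hx)
  have hdlevel := (hρ.hasFDerivAt.comp x hπ.hasFDerivAt).unique
    ((hasFDerivAt_const (0 : ℝ) x).congr_of_eventuallyEq hlevel)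
  have htangent : ∀ v, fderiv ℝ ρ (π x) (fderiv ℝ π x v) = 0 := fun v =>
    DFunLike.congr_fun hdlevel v
  refine ext_inner_right ℝ fun v => ?_
  have hv := congrArg (inner ℝ (unitNormal ρ (π x))) (DFunLike.congr_fun hdx v)
  simpa [inner_add_right, real_inner_smul_right, inner_unitNormal ρ _ (fderiv ℝ π x v), htangent,
    inner_unitNormal_fderiv_unitNormal h h0, real_inner_self_eq_norm_sq, norm_unitNormal h0,
    inner_gradient] using hv

theorem exists_eq_add_smul_unitNormal_of_isLocalMinOn {x : E} (h : ContDiffAt ℝ ∞ ρ y)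
    (h0 : fderiv ℝ ρ y ≠ 0) (hmin : IsLocalMinOn (fun z => ‖x - z‖ ^ 2) {z | ρ z = ρ y} y) :
    ∃ t : ℝ, x = y + t • unitNormal ρ y := by
  obtain ⟨a, b, hab, hL⟩ := IsLocalExtrOn.exists_multipliers_of_hasStrictFDerivAt_1d (Or.inl hmin)
    (h.hasStrictFDerivAt (by simp))
    ((hasStrictFDerivAt_norm_sq (x - y)).comp y ((hasStrictFDerivAt_id y).const_sub x))
  have hb : b ≠ 0 := by
    rintro rfl
    have ha : a ≠ 0 := by simpa using hab
    exact h0 (by simpa [ha] using hL)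
  have hparallel : (2 * b) • (x - y) = a • gradient ρ y := by
    refine ext_inner_right ℝ fun v => ?_
    have hv := DFunLike.congr_fun hL v
    simp only [map_sub, ContinuousLinearMap.comp_neg, ContinuousLinearMap.comp_id, smul_neg,
      add_apply, smul_apply, smul_eq_mul, neg_apply, sub_apply, coe_innerSL_apply, nsmul_eq_mul,
      Nat.cast_ofNat, zero_apply, real_inner_smul_left, inner_sub_left,
      inner_gradient_left] at hv ⊢
    linarith
  refine ⟨(2 * b)⁻¹ * a * ‖gradient ρ y‖, ?_⟩
  rw [← sub_eq_iff_eq_add', unitNormal, smul_smul,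
    mul_inv_cancel_right₀ (norm_ne_zero_iff.2 (gradient_ne_zero h0)), mul_smul, ← hparallel,
    inv_smul_smul₀ (by simpa using hb)]

theorem eventually_add_smul_unitNormal_lt_zero_iff (h : ContDiffAt ℝ ∞ ρ y)
    (h0 : fderiv ℝ ρ y ≠ 0) :
    ∀ᶠ w : E × ℝ in 𝓝 (y, 0), ρ w.1 = 0 → (ρ (w.1 + w.2 • unitNormal ρ w.1) < 0 ↔ w.2 < 0) := by
  set c := ‖gradient ρ y‖ / 2 with hc
  have hcpos : 0 < c := half_pos (norm_pos_iff.2 (gradient_ne_zero h0))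
  have hn : ContinuousAt (fun w : E × ℝ => unitNormal ρ w.1) (y, 0) :=
    ContinuousAt.comp (f := Prod.fst) (g := unitNormal ρ) (x := (y, (0 : ℝ)))
      (contDiffAt_unitNormal h h0).continuousAt continuousAt_fst
  have hnormal : ∀ᶠ w : E × ℝ in 𝓝 (y, 0), c < fderiv ℝ ρ y (unitNormal ρ w.1) := by
    refine ((fderiv ℝ ρ y).continuous.continuousAt.comp hn).eventually (lt_mem_nhds ?_)
    simp only [Function.comp_apply, fderiv_unitNormal]
    linarith
  have hne : ∀ᶠ w : E × ℝ in 𝓝 (y, 0), fderiv ℝ ρ w.1 ≠ 0 :=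
    (continuousAt_fst (p := (y, (0 : ℝ)))).eventually
      ((h.fderiv_right (m := 0) (by simp)).continuousAt.eventually_ne h0)
  have hpair : Tendsto (fun w : E × ℝ => (w.1 + w.2 • unitNormal ρ w.1, w.1)) (𝓝 (y, 0))
      (𝓝 (y, y)) := by
    simpa [ContinuousAt] using
      (continuousAt_fst.add (continuousAt_snd.smul hn)).prodMk continuousAt_fst
  filter_upwards [hnormal, hne,
    hpair.eventually ((h.hasStrictFDerivAt (by simp)).isLittleO.def hcpos)] with w hw hw0 hlin hρw
  have hlin' : |ρ (w.1 + w.2 • unitNormal ρ w.1) - w.2 * fderiv ℝ ρ y (unitNormal ρ w.1)| ≤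
      c * |w.2| := by
    simpa [hρw, norm_smul, norm_unitNormal hw0] using hlin
  rw [abs_le] at hlin'
  rcases lt_or_ge w.2 0 with ht | ht
  · rw [abs_of_neg ht] at hlin'
    exact iff_of_true (by nlinarith) ht
  · rw [abs_of_nonneg ht] at hlin'
    exact iff_of_false (by nlinarith) ht.not_gt

end UnitNormal

section SignedDistance

open Topology Filter

variable {X : Type*} [PseudoMetricSpace X] {S : Set X} {p : X}

open scoped Classical in
/-- The signed distance to the boundary of a set, negative inside the set. -/
def signedInfDist (S : Set X) (x : X) : ℝ :=
  if x ∈ S then -Metric.infDist x (frontier S) else Metric.infDist x (frontier S)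

theorem abs_signedInfDist (S : Set X) (x : X) :
    |signedInfDist S x| = Metric.infDist x (frontier S) := by
  rw [signedInfDist]
  split_ifs
  · rw [abs_neg, abs_of_nonneg Metric.infDist_nonneg]
  · exact abs_of_nonneg Metric.infDist_nonneg

theorem signedInfDist_nonpos {x : X} (hx : x ∈ S) : signedInfDist S x ≤ 0 := by
  rw [signedInfDist, if_pos hx]
  exact neg_nonpos.2 Metric.infDist_nonneg

theorem signedInfDist_nonneg {x : X} (hx : x ∉ S) : 0 ≤ signedInfDist S x := by
  rw [signedInfDist, if_neg hx]
  exact Metric.infDist_nonneg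

theorem tendsto_signedInfDist (hp : p ∈ frontier S) :
    Tendsto (signedInfDist S) (𝓝 p) (𝓝 0) := by
  rw [tendsto_zero_iff_norm_tendsto_zero]
  simp only [Real.norm_eq_abs, abs_signedInfDist]
  simpa [Metric.infDist_zero_of_mem hp] using
    (Metric.continuous_infDist_pt (frontier S)).tendsto p

theorem exists_tendsto_infDist_frontier_eq_dist [ProperSpace X] (hb : Bornology.IsBounded S)
    (hp : p ∈ frontier S) :
    ∃ π : X → X, Tendsto π (𝓝 p) (𝓝 p) ∧
      ∀ x, π x ∈ frontier S ∧ Metric.infDist x (frontier S) = dist x (π x) := by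
  have hcompact : IsCompact (frontier S) :=
    hb.isCompact_closure.of_isClosed_subset isClosed_frontier frontier_subset_closure
  choose π hπ hdist using hcompact.exists_infDist_eq_dist ⟨p, hp⟩
  refine ⟨π, tendsto_iff_dist_tendsto_zero.2 (squeeze_zero (fun _ => dist_nonneg) (fun x => ?_)
    (g := fun x => 2 * dist x p) ?_), fun x => ⟨hπ x, hdist x⟩⟩
  · have := Metric.infDist_le_dist_of_mem (x := x) hp
    rw [hdist] at this
    linarith [dist_triangle_left (π x) p x]
  · simpa using ((continuous_id.dist (continuous_const (y := p))).const_mul 2).tendsto p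

end SignedDistance

section SmoothBoundary

open Topology Filter

variable {E : Type*} [NormedAddCommGroup E] [InnerProductSpace ℝ E]
  {S : Set E} {ρ : E → ℝ} {p : E}

/-- `ρ` is a `C^∞` defining function of `S` near `p`: it is smooth and negative exactly on `S`
there, and `p` is not a critical point of it. -/
structure IsDefiningFunctionAt (S : Set E) (ρ : E → ℝ) (p : E) : Prop where
  contDiffAt : ∀ᶠ x in 𝓝 p, ContDiffAt ℝ ∞ ρ x
  mem_iff : ∀ᶠ x in 𝓝 p, x ∈ S ↔ ρ x < 0
  fderiv_ne_zero : fderiv ℝ ρ p ≠ 0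

namespace IsDefiningFunctionAt

theorem eventually (h : IsDefiningFunctionAt S ρ p) :
    ∀ᶠ x in 𝓝 p, IsDefiningFunctionAt S ρ x := by
  have hne : ∀ᶠ x in 𝓝 p, fderiv ℝ ρ x ≠ 0 :=
    (h.contDiffAt.self_of_nhds.fderiv_right (m := 0) (by simp)).continuousAt.eventually_ne
      h.fderiv_ne_zero
  filter_upwards [h.contDiffAt.eventually_nhds, h.mem_iff.eventually_nhds, hne] with x h₁ h₂ h₃
  exact ⟨h₁, h₂, h₃⟩

theorem mem_frontier_iff (h : IsDefiningFunctionAt S ρ p) (hS : IsOpen S) :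
    p ∈ frontier S ↔ ρ p = 0 := by
  rw [hS.frontier_eq, Set.mem_sdiff, h.mem_iff.self_of_nhds, not_lt]
  refine ⟨fun ⟨hcl, hnonneg⟩ => hnonneg.antisymm' (not_lt.1 fun hpos => ?_), fun hp => ⟨?_, hp.ge⟩⟩
  · obtain ⟨z, ⟨hz, hzpos⟩, hzS⟩ := mem_closure_iff_nhds.1 hcl _
      (h.mem_iff.and (h.contDiffAt.self_of_nhds.continuousAt.eventually (lt_mem_nhds hpos)))
    exact lt_asymm hzpos (hz.1 hzS)
  · by_contra hcl
    refine h.fderiv_ne_zero (IsLocalMin.fderiv_eq_zero ?_)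
    filter_upwards [h.mem_iff, isClosed_closure.isOpen_compl.eventually_mem hcl] with z hz hzcl
    rw [hp]
    exact not_lt.1 fun hneg => hzcl (subset_closure (hz.2 hneg))

end IsDefiningFunctionAt

theorem exists_eq_foot_add_signedInfDist_smul [ProperSpace E] (h : IsDefiningFunctionAt S ρ p)
    (hS : IsOpen S) (hb : Bornology.IsBounded S) (hp : p ∈ frontier S) :
    ∃ π : E → E, Tendsto π (𝓝 p) (𝓝 p) ∧ ∀ᶠ x in 𝓝 p,
      ρ (π x) = 0 ∧ x = π x + signedInfDist S x • unitNormal ρ (π x) := by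
  obtain ⟨π, hπ, hfoot⟩ := exists_tendsto_infDist_frontier_eq_dist hb hp
  have hsign : ∀ᶠ x in 𝓝 p, ρ (π x) = 0 →
      (ρ (π x + (-signedInfDist S x) • unitNormal ρ (π x)) < 0 ↔ -signedInfDist S x < 0) :=
    (hπ.prodMk_nhds (by simpa using (tendsto_signedInfDist hp).neg)).eventually
      (eventually_add_smul_unitNormal_lt_zero_iff h.contDiffAt.self_of_nhds h.fderiv_ne_zero)
  refine ⟨π, hπ, ?_⟩
  filter_upwards [hπ.eventually h.eventually, h.mem_iff, hsign] with x hπx hx hsignx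
  have hzero : ρ (π x) = 0 := (hπx.mem_frontier_iff hS).1 (hfoot x).1
  have hmin : IsLocalMinOn (fun z => ‖x - z‖ ^ 2) {z | ρ z = ρ (π x)} (π x) := by
    filter_upwards [nhdsWithin_le_nhds hπx.eventually, self_mem_nhdsWithin] with z hz hzπ
    have hle := Metric.infDist_le_dist_of_mem (x := x)
      ((hz.mem_frontier_iff hS).2 (hzπ.trans hzero))
    rw [(hfoot x).2, dist_eq_norm, dist_eq_norm] at hle
    gcongr
  obtain ⟨t, ht⟩ := exists_eq_add_smul_unitNormal_of_isLocalMinOn hπx.contDiffAt.self_of_nhds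
    hπx.fderiv_ne_zero hmin
  have habs : |t| = |signedInfDist S x| := by
    rw [abs_signedInfDist, (hfoot x).2, dist_eq_norm, sub_eq_iff_eq_add'.2 ht, norm_smul,
      norm_unitNormal hπx.fderiv_ne_zero, mul_one, Real.norm_eq_abs]
  refine ⟨hzero, ?_⟩
  suffices t = signedInfDist S x by rw [← this]; exact ht
  rcases abs_eq_abs.1 habs with rfl | rfl
  · rfl
  · have hx' := hsignx hzero
    rw [← ht, ← hx] at hx'
    by_cases hxS : x ∈ S
    · linarith [hx'.1 hxS, signedInfDist_nonpos hxS]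
    · linarith [not_lt.1 (mt hx'.2 hxS), signedInfDist_nonneg hxS]

theorem eventually_contDiffAt_signedInfDist [ProperSpace E] (h : IsDefiningFunctionAt S ρ p)
    (hS : IsOpen S) (hb : Bornology.IsBounded S) (hp : p ∈ frontier S) :
    ∀ᶠ x in 𝓝 p, ContDiffAt ℝ ∞ (signedInfDist S) x ∧ ‖gradient (signedInfDist S) x‖ = 1 := by
  obtain ⟨π, t, hπ, hcoord, ht⟩ := exists_normal_coordinates h.contDiffAt h.fderiv_ne_zero
    ((h.mem_frontier_iff hS).1 hp)
  obtain ⟨π', hπ', hfoot⟩ := exists_eq_foot_add_signedInfDist_smul h hS hb hp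
  have heq : signedInfDist S =ᶠ[𝓝 p] t := by
    filter_upwards [hfoot, (hπ'.prodMk_nhds (tendsto_signedInfDist hp)).eventually ht]
      with x hx htx
    rw [← htx hx.1, ← hx.2]
  filter_upwards [hcoord.eventually_nhds, heq.eventuallyEq_nhds, hπ.eventually h.eventually]
    with x hx hxt hρ
  have hgrad := gradient_eq_unitNormal (hx.self_of_nhds.1.differentiableAt (by simp))
    (hx.self_of_nhds.2.1.differentiableAt (by simp)) hρ.contDiffAt.self_of_nhds hρ.fderiv_ne_zero
    (hx.mono fun z hz => hz.2.2.1) (hx.mono fun z hz => hz.2.2.2)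
  refine ⟨hx.self_of_nhds.2.1.congr_of_eventuallyEq hxt, ?_⟩
  rw [hxt.gradient_eq, hgrad, norm_unitNormal hρ.fderiv_ne_zero]

end SmoothBoundary

section DefiningFunctions

open Topology Filter Set

section Extension

open scoped Classical in
/-- The values at `x` of a function that equals `d` on `V` and off `V` is negative on `S` and
positive elsewhere. -/
def signedValues {X : Type*} (S V : Set X) (d : X → ℝ) (x : X) : Set ℝ :=
  if x ∈ V then {d x} else if x ∈ S then Iio 0 else Ioi 0

theorem convex_signedValues {X : Type*} {S V : Set X} {d : X → ℝ} (x : X) :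
    Convex ℝ (signedValues S V d x) := by
  rw [signedValues]
  split_ifs
  exacts [convex_singleton _, convex_Iio 0, convex_Ioi 0]

variable {E : Type*} [NormedAddCommGroup E] [NormedSpace ℝ E] {S O V : Set E} {d : E → ℝ}

theorem exists_local_forall_mem_signedValues (hS : IsOpen S) (hO : IsOpen O)
    (hSO : frontier S ⊆ O) (hSV : frontier S ⊆ V) (hVO : closure V ⊆ O) (hd : ContDiffOn ℝ ∞ d O)
    (hneg : ∀ x ∈ O, x ∈ S ↔ d x < 0) (hzero : ∀ x ∈ O, x ∈ frontier S ↔ d x = 0) (x : E) :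
    ∃ U ∈ 𝓝 x, ∃ g : E → ℝ, ContDiffOn ℝ ∞ g U ∧ ∀ y ∈ U, g y ∈ signedValues S V d y := by
  by_cases hxO : x ∈ O
  · refine ⟨O, hO.mem_nhds hxO, d, hd, fun y hy => ?_⟩
    rw [signedValues]
    split_ifs with hyV hyS
    exacts [rfl, (hneg y hy).1 hyS,
      (not_lt.1 (mt (hneg y hy).2 hyS)).lt_of_ne' (mt (hzero y hy).2 (mt (@hSV y) hyV))]
  have hxV : ∀ᶠ y in 𝓝 x, y ∉ V :=
    (isClosed_closure.isOpen_compl.eventually_mem (mt (@hVO x) hxO)).mono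
      fun y hy => mt (@subset_closure _ _ V y) hy
  by_cases hxS : x ∈ S
  · refine ⟨_, hxV.and (hS.eventually_mem hxS), fun _ => -1, contDiffOn_const, ?_⟩
    rintro y ⟨hyV, hyS⟩
    simp [signedValues, hyV, hyS]
  · have hxcl : x ∉ closure S := fun hcl => hxO (hSO (hS.frontier_eq ▸ ⟨hcl, hxS⟩))
    refine ⟨_, hxV.and (isClosed_closure.isOpen_compl.eventually_mem hxcl), fun _ => 1,
      contDiffOn_const, ?_⟩
    rintro y ⟨hyV, hycl⟩
    simp [signedValues, hyV, mt (@subset_closure _ _ S y) hycl]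

theorem exists_contDiff_definingFunction_eqOn [FiniteDimensional ℝ E] (hS : IsOpen S)
    (hO : IsOpen O) (hSO : frontier S ⊆ O) (hd : ContDiffOn ℝ ∞ d O)
    (hneg : ∀ x ∈ O, x ∈ S ↔ d x < 0) (hzero : ∀ x ∈ O, x ∈ frontier S ↔ d x = 0) :
    ∃ r : E → ℝ, ContDiff ℝ ∞ r ∧ (∀ x, x ∈ S ↔ r x < 0) ∧ (∀ x, x ∈ frontier S ↔ r x = 0) ∧
      ∃ V ⊆ O, IsOpen V ∧ frontier S ⊆ V ∧ EqOn r d V := by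
  obtain ⟨V, hV, hSV, hVO⟩ := normal_exists_closure_subset isClosed_frontier hO hSO
  obtain ⟨r, hr⟩ := exists_contMDiffMap_forall_mem_convex_of_local (modelWithCornersSelf ℝ E)
    convex_signedValues fun x =>
      let ⟨U, hU, g, hg, hgU⟩ :=
        exists_local_forall_mem_signedValues hS hO hSO hSV hVO hd hneg hzero x
      ⟨U, hU, g, hg.contMDiffOn, hgU⟩
  have hrV : EqOn r d V := fun x hx =>
    mem_singleton_iff.1 (by simpa only [signedValues, if_pos hx] using hr x)
  have hsign : ∀ x, (x ∈ S ↔ r x < 0) ∧ (x ∈ frontier S ↔ r x = 0) := fun x => by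
    by_cases hxV : x ∈ V
    · have hxO := hVO (subset_closure hxV)
      exact hrV hxV ▸ ⟨hneg x hxO, hzero x hxO⟩
    · have hrx := hr x
      rw [signedValues, if_neg hxV] at hrx
      split_ifs at hrx with hxS
      · exact ⟨iff_of_true hxS hrx, iff_of_false (mt (@hSV x) hxV) (ne_of_lt hrx)⟩
      · exact ⟨iff_of_false hxS (lt_asymm hrx), iff_of_false (mt (@hSV x) hxV) (ne_of_gt hrx)⟩
  exact ⟨r, r.contMDiff.contDiff, fun x => (hsign x).1, fun x => (hsign x).2, V,
    subset_closure.trans hVO, hV, hSV, hrV⟩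

end Extension

variable {n : ℕ} {Ω : SmoothlyBoundedDomain n}

theorem inner_dirVec (i : RealIdx n) (v : Cn n) :
    inner ℝ (dirVec i) v = Sum.elim (fun j => (v j).re) (fun j => (v j).im) i := by
  rcases i with j | j <;>
    simp only [dirVec, PiLp.inner_apply, Complex.inner, Sum.elim_inl, Sum.elim_inr] <;>
    rw [Finset.sum_eq_single j] <;> simp +contextual

theorem sum_inner_dirVec_smul (v : Cn n) :
    ∑ i : RealIdx n, inner ℝ (dirVec i) v • dirVec i = v := by
  ext j
  simp only [inner_dirVec]
  simp only [Fintype.sum_sum_type, dirVec, Sum.elim_inl, Sum.elim_inr,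
    PiLp.add_apply, WithLp.ofLp_sum, Finset.sum_apply, PiLp.smul_apply]
  rw [Finset.sum_eq_single j, Finset.sum_eq_single j]
  · simp [Complex.re_add_im]
  all_goals simp +contextual [eq_comm]

theorem sum_inner_dirVec_sq (v : Cn n) :
    ∑ i : RealIdx n, inner ℝ (dirVec i) v ^ 2 = ‖v‖ ^ 2 :=
  calc ∑ i : RealIdx n, inner ℝ (dirVec i) v ^ 2
      = inner ℝ (∑ i : RealIdx n, inner ℝ (dirVec i) v • dirVec i) v := by
        simp only [sum_inner, real_inner_smul_left, sq]
    _ = ‖v‖ ^ 2 := by rw [sum_inner_dirVec_smul, real_inner_self_eq_norm_sq]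

/-- A smooth global defining function of `Ω` which near the boundary is the signed distance and
has unit gradient there. -/
structure DefiningFunction (Ω : SmoothlyBoundedDomain n) where
  toFun : Cn n → ℝ
  smooth : ContDiff ℝ ∞ toFun
  neg_iff : ∀ x, x ∈ Ω.carrier ↔ toFun x < 0
  zero_iff : ∀ x, x ∈ frontier Ω.carrier ↔ toFun x = 0
  nhd : Set (Cn n)
  isOpen_nhd : IsOpen nhd
  frontier_subset : frontier Ω.carrier ⊆ nhd
  eq_signedDist : ∀ x ∈ nhd, toFun x = signedDist Ω x
  norm_gradient : ∀ x ∈ nhd, ‖gradient toFun x‖ = 1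

theorem signedDist_eq_signedInfDist (Ω : SmoothlyBoundedDomain n) :
    signedDist Ω = signedInfDist Ω.carrier := rfl

theorem eventually_contDiffAt_signedDist (Ω : SmoothlyBoundedDomain n) {p : Cn n}
    (hp : p ∈ frontier Ω.carrier) :
    ∀ᶠ x in 𝓝 p, ContDiffAt ℝ ∞ (signedDist Ω) x ∧ ‖gradient (signedDist Ω) x‖ = 1 := by
  obtain ⟨U, hU, hpU, ρ, hρ, h0, hiff⟩ := Ω.smooth_boundary p hp
  have hdef : IsDefiningFunctionAt Ω.carrier ρ p :=
    ⟨(hU.eventually_mem hpU).mono fun x hx => hρ.contDiffAt (hU.mem_nhds hx),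
      (hU.eventually_mem hpU).mono hiff, h0⟩
  exact eventually_contDiffAt_signedInfDist hdef Ω.isOpen Ω.isBounded hp

theorem nonempty_definingFunction (Ω : SmoothlyBoundedDomain n) :
    Nonempty (DefiningFunction Ω) := by
  set O : Set (Cn n) :=
    interior {x | ContDiffAt ℝ ∞ (signedDist Ω) x ∧ ‖gradient (signedDist Ω) x‖ = 1}
  have hO : ∀ x ∈ O, ContDiffAt ℝ ∞ (signedDist Ω) x ∧ ‖gradient (signedDist Ω) x‖ = 1 :=
    fun _ hx => (interior_subset hx :)
  have hzero : ∀ x ∈ O, x ∈ frontier Ω.carrier ↔ signedDist Ω x = 0 := fun x hx => by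
    have hne : (frontier Ω.carrier).Nonempty := by
      by_contra! hempty
      have hconst : signedDist Ω = fun _ => 0 := by
        ext y
        simp [signedDist, hempty]
      simpa [hconst, gradient] using (hO x hx).2
    rw [isClosed_frontier.mem_iff_infDist_zero hne, ← abs_signedInfDist, abs_eq_zero,
      signedDist_eq_signedInfDist]
  have hneg : ∀ x ∈ O, x ∈ Ω.carrier ↔ signedDist Ω x < 0 := fun x hx => by
    refine ⟨fun hxΩ => (signedInfDist_nonpos hxΩ).lt_of_ne fun h => ?_, fun h => ?_⟩
    · exact (Ω.isOpen.frontier_eq ▸ (hzero x hx).2 h).2 hxΩ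
    · by_contra hxΩ
      exact (signedInfDist_nonneg hxΩ).not_gt h
  obtain ⟨r, hr, hrneg, hrzero, V, hVO, hV, hΩV, hrV⟩ := exists_contDiff_definingFunction_eqOn
    Ω.isOpen isOpen_interior
    (fun p hp => mem_interior_iff_mem_nhds.2 (eventually_contDiffAt_signedDist Ω hp))
    (fun x hx => (hO x hx).1.contDiffWithinAt) hneg hzero
  exact ⟨⟨r, hr, hrneg, hrzero, V, hV, hΩV, hrV, fun x hx =>
    (hrV.eventuallyEq_of_mem (hV.mem_nhds hx)).gradient_eq ▸ (hO x (hVO hx)).2⟩⟩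

namespace DefiningFunction

variable (r : DefiningFunction Ω)

/-- The derivatives of the defining function, as complex-valued functions. On the boundary they
are the components of the outer unit normal. -/
def nu (i : RealIdx n) : Cn n → ℂ := partialD i fun x => (r.toFun x : ℂ)

theorem contDiff_ofReal : ContDiff ℝ ∞ fun x => (r.toFun x : ℂ) :=
  Complex.ofRealCLM.contDiff.comp r.smooth

theorem contDiff_nu (i : RealIdx n) : ContDiff ℝ ∞ (r.nu i) :=
  contDiff_partialD i r.contDiff_ofReal

theorem nu_apply (i : RealIdx n) (x : Cn n) :
    r.nu i x = (inner ℝ (dirVec i) (gradient r.toFun x) : ℝ) := by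
  have hderiv : HasFDerivAt (fun x => (r.toFun x : ℂ))
      (Complex.ofRealCLM.comp (fderiv ℝ r.toFun x)) x :=
    Complex.ofRealCLM.hasFDerivAt.comp x (r.smooth.differentiable (by simp) x).hasFDerivAt
  rw [nu, partialD, hderiv.fderiv, real_inner_comm, inner_gradient]
  rfl

theorem conj_nu (i : RealIdx n) (x : Cn n) : (starRingEnd ℂ) (r.nu i x) = r.nu i x := by
  rw [nu_apply, Complex.conj_ofReal]

theorem sum_nu_mul_self {x : Cn n} (hx : x ∈ r.nhd) : ∑ i, r.nu i x * r.nu i x = 1 := by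
  have h := sum_inner_dirVec_sq (gradient r.toFun x)
  rw [r.norm_gradient x hx, one_pow] at h
  simp only [nu_apply, ← sq]
  exact_mod_cast h

theorem fderiv_gradient (f : Cn n → ℂ) (x : Cn n) :
    fderiv ℝ f x (gradient r.toFun x) = ∑ i, r.nu i x * partialD i f x := by
  conv_lhs => rw [← sum_inner_dirVec_smul (gradient r.toFun x)]
  simp only [map_sum, map_smul, nu_apply, partialD, Complex.real_smul]

end DefiningFunction

end DefiningFunctions

/-! ### Integration by parts -/

section DivergenceTheorem

open Topology Filter

section PartialDerivatives

variable {n : ℕ} {f g : Cn n → ℂ}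

theorem partialD_mul (i : RealIdx n) (hf : ContDiff ℝ ∞ f) (hg : ContDiff ℝ ∞ g) (x : Cn n) :
    partialD i (fun y => f y * g y) x = partialD i f x * g x + f x * partialD i g x := by
  rw [partialD, fderiv_fun_mul (hf.differentiable (by simp) x) (hg.differentiable (by simp) x)]
  simp only [add_apply, smul_apply, smul_eq_mul, partialD]
  ring

theorem partialD_sub (i : RealIdx n) (hf : ContDiff ℝ ∞ f) (hg : ContDiff ℝ ∞ g) (x : Cn n) :
    partialD i (fun y => f y - g y) x = partialD i f x - partialD i g x := by
  rw [partialD, fderiv_fun_sub (hf.differentiable (by simp) x) (hg.differentiable (by simp) x)]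
  rfl

theorem partialD_sum {ι : Type*} (s : Finset ι) (i : RealIdx n) {f : ι → Cn n → ℂ}
    (hf : ∀ j, ContDiff ℝ ∞ (f j)) (x : Cn n) :
    partialD i (fun y => ∑ j ∈ s, f j y) x = ∑ j ∈ s, partialD i (f j) x := by
  rw [partialD, fderiv_fun_sum fun j _ => (hf j).differentiable (by simp) x]
  simp [partialD]

theorem contDiff_sum_mul {ι : Type*} (s : Finset ι) {f g : ι → Cn n → ℂ}
    (hf : ∀ j, ContDiff ℝ ∞ (f j)) (hg : ∀ j, ContDiff ℝ ∞ (g j)) :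
    ContDiff ℝ ∞ fun x => ∑ j ∈ s, f j x * g j x :=
  ContDiff.sum fun j _ => (hf j).mul (hg j)

theorem continuous_sum_partialD {V : RealIdx n → Cn n → ℂ} (hV : ∀ i, ContDiff ℝ ∞ (V i)) :
    Continuous fun x => ∑ i, partialD i (V i) x :=
  continuous_finsetSum _ fun i _ => (contDiff_partialD i (hV i)).continuous

theorem integral_partialD_eq_zero (i : RealIdx n) (hg : ContDiff ℝ ∞ g)
    (hc : HasCompactSupport g) : ∫ x, partialD i g x = 0 := by
  have hint : Integrable (partialD i g) :=
    (contDiff_partialD i hg).continuous.integrable_of_hasCompactSupport (hc.fderiv_apply ℝ _)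
  have := integral_mul_fderiv_eq_neg_fderiv_mul_of_integrable (μ := (volume : Measure (Cn n)))
    (f := fun _ => (1 : ℂ)) (g := g) (v := dirVec i) (by simp) (by simp only [one_mul]; exact hint)
    (by simpa using hg.continuous.integrable_of_hasCompactSupport hc)
    (fun x _ => differentiableAt_const _) (fun x _ => hg.differentiable (by simp) x)
  simpa [partialD] using this

theorem integrableOn_of_continuous (Ω : SmoothlyBoundedDomain n) {F : Type*}
    [NormedAddCommGroup F] {u : Cn n → F} (hu : Continuous u) : IntegrableOn u Ω.carrier :=
  (hu.continuousOn.integrableOn_compact Ω.isBounded.isCompact_closure).mono_set subset_closure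

end PartialDerivatives

theorem exists_norm_le_mul_infDist {E F : Type*} [NormedAddCommGroup E] [NormedSpace ℝ E]
    [ProperSpace E] [NormedAddCommGroup F] [NormedSpace ℝ F] {u : E → F} (hu : ContDiff ℝ 1 u)
    {S K : Set E} (hS : IsCompact S) (hne : S.Nonempty) (hK : Bornology.IsBounded K)
    (h0 : ∀ x ∈ S, u x = 0) : ∃ C, ∀ x ∈ K, ‖u x‖ ≤ C * Metric.infDist x S := by
  obtain ⟨R, hR⟩ := (hK.union hS.isBounded).subset_closedBall 0
  obtain ⟨C, hC⟩ := hu.contDiffOn.exists_lipschitzOnWith one_ne_zero (convex_closedBall 0 R)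
    (isCompact_closedBall 0 R)
  refine ⟨C, fun x hx => ?_⟩
  obtain ⟨y, hy, hxy⟩ := hS.exists_infDist_eq_dist hne x
  simpa [h0 y hy, ← hxy] using hC.dist_le_mul x (hR (Or.inl hx)) y (hR (Or.inr hy))

theorem deriv_smoothTransition_of_neg {t : ℝ} (ht : t < 0) : deriv Real.smoothTransition t = 0 := by
  have heq : Real.smoothTransition =ᶠ[𝓝 t] fun _ => 0 :=
    (gt_mem_nhds ht).mono fun _ hz => Real.smoothTransition.zero_of_nonpos (le_of_lt hz)
  rw [heq.deriv_eq, deriv_const]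

theorem deriv_smoothTransition_of_one_lt {t : ℝ} (ht : 1 < t) :
    deriv Real.smoothTransition t = 0 := by
  have heq : Real.smoothTransition =ᶠ[𝓝 t] fun _ => 1 :=
    (lt_mem_nhds ht).mono fun _ hz => Real.smoothTransition.one_of_one_le (le_of_lt hz)
  rw [heq.deriv_eq, deriv_const]

theorem continuous_deriv_smoothTransition : Continuous (deriv Real.smoothTransition) :=
  (Real.smoothTransition.contDiff (n := 1)).continuous_deriv le_rfl

theorem exists_abs_mul_deriv_smoothTransition_le :
    ∃ B, ∀ t, |(t + 1) * deriv Real.smoothTransition t| ≤ B := by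
  obtain ⟨B, hB⟩ := (isCompact_Icc (a := (0 : ℝ)) (b := 1)).exists_bound_of_continuousOn
    ((continuous_add_const (1 : ℝ)).mul continuous_deriv_smoothTransition).continuousOn
  refine ⟨max B 0, fun t => ?_⟩
  rcases lt_or_ge t 0 with h | h
  · simp [deriv_smoothTransition_of_neg h]
  rcases lt_or_ge 1 t with h' | h'
  · simp [deriv_smoothTransition_of_one_lt h']
  · exact (hB t ⟨h, h'⟩).trans (le_max_left _ _)

namespace DefiningFunction

variable {n : ℕ} {Ω : SmoothlyBoundedDomain n} (r : DefiningFunction Ω)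

theorem abs_toFun {x : Cn n} (hx : x ∈ r.nhd) :
    |r.toFun x| = Metric.infDist x (frontier Ω.carrier) := by
  rw [r.eq_signedDist x hx, signedDist_eq_signedInfDist, abs_signedInfDist]

theorem exists_norm_le_mul_abs_toFun {u : Cn n → ℂ} (hu : ContDiff ℝ ∞ u)
    (h0 : ∀ x ∈ frontier Ω.carrier, u x = 0) : ∃ C, ∀ x ∈ Ω.carrier, ‖u x‖ ≤ C * |r.toFun x| := by
  have hK : IsCompact (closure Ω.carrier) := Ω.isBounded.isCompact_closure
  have haway : ∃ C, ∀ x ∈ Ω.carrier, x ∉ r.nhd → ‖u x‖ ≤ C * |r.toFun x| := by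
    have hpos : ∀ x ∈ closure Ω.carrier \ r.nhd, r.toFun x ≠ 0 := fun x hx h =>
      hx.2 (r.frontier_subset ((r.zero_iff x).2 h))
    obtain ⟨C, hC⟩ := (hK.diff r.isOpen_nhd).exists_bound_of_continuousOn
      (hu.continuous.norm.continuousOn.div r.smooth.continuous.continuousOn hpos)
    refine ⟨C, fun x hx hxn => ?_⟩
    have hx' : x ∈ closure Ω.carrier \ r.nhd := ⟨subset_closure hx, hxn⟩
    have hle := hC x hx'
    rwa [Pi.div_apply, norm_div, norm_norm, Real.norm_eq_abs,
      div_le_iff₀ (abs_pos.2 (hpos x hx'))] at hle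
  have hnear : ∃ C, ∀ x ∈ Ω.carrier, x ∈ r.nhd → ‖u x‖ ≤ C * |r.toFun x| := by
    rcases (frontier Ω.carrier).eq_empty_or_nonempty with hempty | hne
    · refine ⟨0, fun x _ hxn => ?_⟩
      have hx0 : x ∈ frontier Ω.carrier := (r.zero_iff x).2 <| abs_eq_zero.1 <| by
        rw [r.abs_toFun hxn, hempty, Metric.infDist_empty]
      simp [hempty] at hx0
    · obtain ⟨C, hC⟩ := exists_norm_le_mul_infDist (hu.of_le (by simp))
        (hK.of_isClosed_subset isClosed_frontier frontier_subset_closure) hne Ω.isBounded h0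
      exact ⟨C, fun x hx hxn => by rw [r.abs_toFun hxn]; exact hC x hx⟩
  obtain ⟨C, hC⟩ := haway
  obtain ⟨D, hD⟩ := hnear
  refine ⟨max C D, fun x hx => ?_⟩
  by_cases hxn : x ∈ r.nhd
  · exact (hD x hx hxn).trans (by gcongr; exact le_max_right C D)
  · exact (hC x hx hxn).trans (by gcongr; exact le_max_left C D)

/-- A smooth function with support in `Ω` which is `1` at distance more than about `2 / m` from the
boundary. -/
def cutoff (m : ℕ) (x : Cn n) : ℂ := (Real.smoothTransition (-(m * r.toFun x) - 1) : ℝ)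

/-- Minus the derivative of `cutoff` with respect to the defining function. -/
def cutoffDeriv (m : ℕ) (x : Cn n) : ℂ :=
  (m * deriv Real.smoothTransition (-(m * r.toFun x) - 1) : ℝ)

theorem contDiff_cutoff (m : ℕ) : ContDiff ℝ ∞ (r.cutoff m) :=
  Complex.ofRealCLM.contDiff.comp (Real.smoothTransition.contDiff.comp
    ((contDiff_const.mul r.smooth).neg.sub contDiff_const))

theorem continuous_cutoffDeriv (m : ℕ) : Continuous (r.cutoffDeriv m) :=
  Complex.continuous_ofReal.comp (continuous_const.mul (continuous_deriv_smoothTransition.comp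
    ((continuous_const.mul r.smooth.continuous).neg.sub continuous_const)))

theorem partialD_cutoff (m : ℕ) (i : RealIdx n) (x : Cn n) :
    partialD i (r.cutoff m) x = -(r.cutoffDeriv m x * r.nu i x) := by
  have hr : HasFDerivAt (fun x => -(m * r.toFun x) - 1) (-((m : ℝ) • fderiv ℝ r.toFun x)) x :=
    (((r.smooth.differentiable (by simp) x).hasFDerivAt.const_mul (m : ℝ)).neg).sub_const 1
  have hT := ((Real.smoothTransition.contDiff (n := 1)).differentiable one_ne_zero
    (-(m * r.toFun x) - 1)).hasDerivAt.comp_hasFDerivAt x hr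
  have hcutoff : HasFDerivAt (r.cutoff m) _ x := Complex.ofRealCLM.hasFDerivAt.comp x hT
  rw [partialD, hcutoff.fderiv, r.nu_apply, real_inner_comm, inner_gradient]
  simp [cutoffDeriv]
  ring

theorem cutoffArg_neg (m : ℕ) {x : Cn n} (hx : x ∉ Ω.carrier) : -(m * r.toFun x) - 1 < 0 := by
  rw [r.neg_iff, not_lt] at hx
  linarith [mul_nonneg (Nat.cast_nonneg (α := ℝ) m) hx]

theorem cutoff_of_notMem (m : ℕ) {x : Cn n} (hx : x ∉ Ω.carrier) : r.cutoff m x = 0 := by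
  rw [cutoff, Real.smoothTransition.zero_of_nonpos (r.cutoffArg_neg m hx).le, Complex.ofReal_zero]

theorem cutoffDeriv_of_notMem (m : ℕ) {x : Cn n} (hx : x ∉ Ω.carrier) : r.cutoffDeriv m x = 0 := by
  rw [cutoffDeriv, deriv_smoothTransition_of_neg (r.cutoffArg_neg m hx), mul_zero,
    Complex.ofReal_zero]

theorem eventually_cutoff {x : Cn n} (hx : x ∈ Ω.carrier) :
    ∀ᶠ m in atTop, r.cutoff m x = 1 ∧ r.cutoffDeriv m x = 0 := by
  have hlim : Tendsto (fun m : ℕ => (m : ℝ) * -r.toFun x) atTop atTop :=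
    tendsto_natCast_atTop_atTop.atTop_mul_const (neg_pos.2 ((r.neg_iff x).1 hx))
  filter_upwards [hlim.eventually_gt_atTop 2] with m hm
  have harg : 1 < -(m * r.toFun x) - 1 := by linarith
  rw [cutoff, cutoffDeriv, Real.smoothTransition.one_of_one_le harg.le,
    deriv_smoothTransition_of_one_lt harg, mul_zero]
  simp

theorem norm_cutoff_le_one (m : ℕ) (x : Cn n) : ‖r.cutoff m x‖ ≤ 1 := by
  rw [cutoff, Complex.norm_real, Real.norm_of_nonneg (Real.smoothTransition.nonneg _)]
  exact Real.smoothTransition.le_one _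

theorem exists_norm_cutoffDeriv_mul_abs_le :
    ∃ B, ∀ m x, ‖r.cutoffDeriv m x‖ * |r.toFun x| ≤ B := by
  obtain ⟨B, hB⟩ := exists_abs_mul_deriv_smoothTransition_le
  refine ⟨B, fun m x => le_of_eq_of_le ?_ (hB (-(m * r.toFun x) - 1))⟩
  rw [cutoffDeriv, Complex.norm_real, Real.norm_eq_abs, sub_add_cancel, ← abs_mul, neg_mul, abs_neg]
  ring_nf

section Divergence

variable {V : RealIdx n → Cn n → ℂ} (hV : ∀ i, ContDiff ℝ ∞ (V i))
include hV

theorem integral_cutoff_mul_divergence (m : ℕ) :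
    ∫ x in Ω.carrier, r.cutoff m x * ∑ i, partialD i (V i) x =
      ∫ x in Ω.carrier, r.cutoffDeriv m x * ∑ i, V i x * r.nu i x := by
  have hsmooth : ∀ i, ContDiff ℝ ∞ fun y => r.cutoff m y * V i y := fun i =>
    (r.contDiff_cutoff m).mul (hV i)
  have hcompact : ∀ i, HasCompactSupport fun y => r.cutoff m y * V i y := fun i =>
    HasCompactSupport.intro Ω.isBounded.isCompact_closure fun x hx => by
      rw [r.cutoff_of_notMem m (mt (@subset_closure _ _ _ x) hx), zero_mul]
  have hdiv : ∀ x, ∑ i, partialD i (fun y => r.cutoff m y * V i y) x =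
      r.cutoff m x * ∑ i, partialD i (V i) x - r.cutoffDeriv m x * ∑ i, V i x * r.nu i x := by
    intro x
    simp only [partialD_mul _ (r.contDiff_cutoff m) (hV _), partialD_cutoff, Finset.mul_sum,
      ← Finset.sum_sub_distrib]
    exact Finset.sum_congr rfl fun i _ => by ring
  have hzero : ∫ x in Ω.carrier, ∑ i, partialD i (fun y => r.cutoff m y * V i y) x = 0 := by
    rw [setIntegral_eq_integral_of_forall_compl_eq_zero, integral_finsetSum]
    · exact Finset.sum_eq_zero fun i _ => integral_partialD_eq_zero i (hsmooth i) (hcompact i)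
    · exact fun i _ => (contDiff_partialD i (hsmooth i)).continuous.integrable_of_hasCompactSupport
        ((hcompact i).fderiv_apply ℝ _)
    · intro x hx
      rw [hdiv, r.cutoff_of_notMem m hx, r.cutoffDeriv_of_notMem m hx, zero_mul, zero_mul, sub_zero]
  simp only [hdiv] at hzero
  rwa [integral_sub, sub_eq_zero] at hzero
  · exact integrableOn_of_continuous Ω
      ((r.contDiff_cutoff m).continuous.mul (continuous_sum_partialD hV))
  · exact integrableOn_of_continuous Ω
      ((r.continuous_cutoffDeriv m).mul (contDiff_sum_mul _ hV r.contDiff_nu).continuous)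

theorem tendsto_integral_cutoff_mul_divergence :
    Tendsto (fun m => ∫ x in Ω.carrier, r.cutoff m x * ∑ i, partialD i (V i) x) atTop
      (𝓝 (∫ x in Ω.carrier, ∑ i, partialD i (V i) x)) := by
  have hcont := continuous_sum_partialD hV
  refine tendsto_integral_of_dominated_convergence (fun x => ‖∑ i, partialD i (V i) x‖)
    (fun m => ((r.contDiff_cutoff m).continuous.mul hcont).aestronglyMeasurable)
    (integrableOn_of_continuous Ω hcont.norm) (fun m => ae_of_all _ fun x => ?_) ?_
  · rw [norm_mul]
    exact mul_le_of_le_one_left (norm_nonneg _) (r.norm_cutoff_le_one m x)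
  · filter_upwards [ae_restrict_mem Ω.isOpen.measurableSet] with x hx
    refine tendsto_const_nhds.congr' ((r.eventually_cutoff hx).mono fun m hm => ?_)
    simp only [hm.1, one_mul]

theorem tendsto_integral_cutoffDeriv_mul_normalComponent
    (h0 : ∀ x ∈ frontier Ω.carrier, ∑ i, V i x * r.nu i x = 0) :
    Tendsto (fun m => ∫ x in Ω.carrier, r.cutoffDeriv m x * ∑ i, V i x * r.nu i x) atTop
      (𝓝 0) := by
  have hsmooth := contDiff_sum_mul Finset.univ hV r.contDiff_nu
  obtain ⟨C, hC⟩ := r.exists_norm_le_mul_abs_toFun hsmooth h0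
  obtain ⟨B, hB⟩ := r.exists_norm_cutoffDeriv_mul_abs_le
  rw [← integral_zero (Cn n) ℂ (μ := volume.restrict Ω.carrier)]
  refine tendsto_integral_of_dominated_convergence (fun _ => |C| * B)
    (fun m => ((r.continuous_cutoffDeriv m).mul hsmooth.continuous).aestronglyMeasurable)
    (integrableOn_of_continuous Ω continuous_const) (fun m => ?_) ?_
  · filter_upwards [ae_restrict_mem Ω.isOpen.measurableSet] with x hx
    calc ‖r.cutoffDeriv m x * ∑ i, V i x * r.nu i x‖
        ≤ ‖r.cutoffDeriv m x‖ * (|C| * |r.toFun x|) := by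
          rw [norm_mul]
          gcongr
          exact (hC x hx).trans (by gcongr; exact le_abs_self C)
      _ = |C| * (‖r.cutoffDeriv m x‖ * |r.toFun x|) := by ring
      _ ≤ |C| * B := by gcongr; exact hB m x
  · filter_upwards [ae_restrict_mem Ω.isOpen.measurableSet] with x hx
    refine tendsto_const_nhds.congr' ((r.eventually_cutoff hx).mono fun m hm => ?_)
    simp only [hm.2, zero_mul]

theorem integral_divergence_eq_zero (h0 : ∀ x ∈ frontier Ω.carrier, ∑ i, V i x * r.nu i x = 0) :
    ∫ x in Ω.carrier, ∑ i, partialD i (V i) x = 0 :=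
  tendsto_nhds_unique (r.tendsto_integral_cutoff_mul_divergence hV) <| by
    simpa only [r.integral_cutoff_mul_divergence hV] using
      r.tendsto_integral_cutoffDeriv_mul_normalComponent hV h0

end Divergence

/-- The integral of `f` over the boundary, written as the integral over `Ω` of the divergence of
the vector field `f ν`. -/
def boundaryIntegral (f : Cn n → ℂ) : ℂ :=
  ∫ x in Ω.carrier, ∑ i, partialD i (fun y => f y * r.nu i y) x

theorem integral_divergence {V : RealIdx n → Cn n → ℂ} (hV : ∀ i, ContDiff ℝ ∞ (V i))
    {f : Cn n → ℂ} (hf : ContDiff ℝ ∞ f)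
    (h0 : ∀ x ∈ frontier Ω.carrier, ∑ i, V i x * r.nu i x = f x) :
    ∫ x in Ω.carrier, ∑ i, partialD i (V i) x = r.boundaryIntegral f := by
  have hfν : ∀ i, ContDiff ℝ ∞ fun y => f y * r.nu i y := fun i => hf.mul (r.contDiff_nu i)
  rw [← sub_eq_zero, boundaryIntegral, ← integral_sub
    (integrableOn_of_continuous Ω (continuous_sum_partialD hV))
    (integrableOn_of_continuous Ω (continuous_sum_partialD hfν))]
  simp only [← Finset.sum_sub_distrib, ← partialD_sub _ (hV _) (hfν _)]
  refine r.integral_divergence_eq_zero (fun i => (hV i).sub (hfν i)) fun x hx => ?_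
  simp only [sub_mul, Finset.sum_sub_distrib, h0 x hx, mul_assoc, ← Finset.mul_sum,
    r.sum_nu_mul_self (r.frontier_subset hx), mul_one, sub_self]

end DefiningFunction
end DivergenceTheorem

/-! ### Reduction to normal derivatives -/

section Derivatives

open MvPolynomial

variable {n : ℕ}

theorem partialD_comm (i j : RealIdx n) {f : Cn n → ℂ} (hf : ContDiff ℝ ∞ f) :
    partialD i (partialD j f) = partialD j (partialD i f) := by
  have hd : Differentiable ℝ (fderiv ℝ f) :=
    (hf.fderiv_right (m := ∞) (by simp)).differentiable (by simp)
  have hsecond : ∀ (k l : RealIdx n) (x : Cn n),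
      partialD k (partialD l f) x = fderiv ℝ (fderiv ℝ f) x (dirVec k) (dirVec l) := fun k l x => by
    have hl : HasFDerivAt (partialD l f) _ x :=
      (hd x).hasFDerivAt.clm_apply (hasFDerivAt_const (dirVec l) x)
    rw [partialD, hl.fderiv]
    simp
  ext x
  rw [hsecond, hsecond]
  exact (hf.contDiffAt.isSymmSndFDerivAt
    (by rw [minSmoothness_of_isRCLikeNormedField]; exact ENat.LEInfty.out)) _ _

theorem commute_smoothD (i j : RealIdx n) : Commute (smoothD i) (smoothD j) :=
  LinearMap.ext fun f => Subtype.ext (partialD_comm i j (contDiff_coe f))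

open scoped IsMulCommutative in
/-- The differential operator with constant coefficients `p(D)` given by a polynomial `p`. -/
def diffOp : MvPolynomial (RealIdx n) ℂ →ₐ[ℂ] Module.End ℂ (SmoothFn n) :=
  haveI := Algebra.isMulCommutative_adjoin ℂ (s := Set.range (smoothD (n := n))) (by
    rintro _ ⟨i, rfl⟩ _ ⟨j, rfl⟩
    exact commute_smoothD i j)
  (Algebra.adjoin ℂ (Set.range (smoothD (n := n)))).val.comp
    (aeval (S₁ := Algebra.adjoin ℂ (Set.range (smoothD (n := n)))) fun i =>
      ⟨smoothD i, Algebra.subset_adjoin ⟨i, rfl⟩⟩)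

theorem diffOp_X (i : RealIdx n) : diffOp (X i) = smoothD i := by
  simp [diffOp]

theorem diffOp_monomial (α : RealIdx n →₀ ℕ) : diffOp (monomial α 1) = smoothDMulti α := by
  have h : (monomial α 1 : MvPolynomial (RealIdx n) ℂ) =
      ((List.finRange n).map fun j => X (Sum.inl j) ^ α (Sum.inl j)).prod *
        ((List.finRange n).map fun j => X (Sum.inr j) ^ α (Sum.inr j)).prod := by
    rw [monomial_eq, C_1, one_mul, Finsupp.prod_fintype _ _ fun i => pow_zero _,
      Fintype.prod_sum_type, Fin.prod_univ_def, Fin.prod_univ_def]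
  rw [h, map_mul, map_list_prod, map_list_prod, List.map_map, List.map_map]
  simp only [Function.comp_def, map_pow, diffOp_X, smoothDMulti]

theorem smoothDMulti_zero : smoothDMulti (0 : RealIdx n → ℕ) = 1 := by
  rw [← Finsupp.coe_zero, ← diffOp_monomial, monomial_zero', C_1, map_one]

theorem smoothDMulti_add_single (α : RealIdx n → ℕ) (i : RealIdx n) :
    smoothDMulti (α + Pi.single i 1) = smoothDMulti α * smoothD i := by
  classical
  obtain ⟨α, rfl⟩ := Finsupp.equivFunOnFinite.surjective α
  change smoothDMulti (⇑α + _) = smoothDMulti ⇑α * _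
  rw [← Finsupp.single_eq_pi_single, ← Finsupp.coe_add, ← diffOp_monomial, ← diffOp_monomial,
    ← diffOp_X, ← map_mul, X, monomial_mul, one_mul]

theorem multiIdx_induction {P : (RealIdx n → ℕ) → Prop} (zero : P 0)
    (add_single : ∀ α i, P α → P (α + Pi.single i 1)) (α : RealIdx n → ℕ) : P α := by
  induction hm : ∑ i, α i generalizing α with
  | zero =>
    have hα : α = 0 := funext fun i => Finset.sum_eq_zero_iff.1 hm i (Finset.mem_univ i)
    rwa [hα]
  | succ m ih =>
    obtain ⟨i, -, hi⟩ := Finset.exists_ne_zero_of_sum_ne_zero (hm.trans_ne m.succ_ne_zero)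
    have hα : α - Pi.single i 1 + Pi.single i 1 = α :=
      tsub_add_cancel_of_le <| update_le_iff.2
        ⟨Nat.one_le_iff_ne_zero.2 hi, fun _ _ => Nat.zero_le _⟩
    rw [← hα]
    refine add_single _ i (ih _ ?_)
    rw [← hα] at hm
    simpa [Finset.sum_add_distrib] using hm

/-- The sum over all `t`-tuples of directions of
`(D_{i₁} ⋯ D_{i_t} f) \overline{D_{i₁} ⋯ D_{i_t} g}`. -/
def jetPairing : ℕ → SmoothFn n → SmoothFn n → Cn n → ℂ
  | 0, f, g => fun x => (f : Cn n → ℂ) x * (starRingEnd ℂ) ((g : Cn n → ℂ) x)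
  | t + 1, f, g => fun x => ∑ i, jetPairing t (smoothD i f) (smoothD i g) x

/-- The linear functional on polynomials sending `X^α` to `D^α f(x) \overline{D^α g(x)}`. -/
def pairingFunctional (f g : SmoothFn n) (x : Cn n) : MvPolynomial (RealIdx n) ℂ →ₗ[ℂ] ℂ :=
  (basisMonomials (RealIdx n) ℂ).constr ℂ fun α =>
    (smoothDMulti α f : Cn n → ℂ) x * (starRingEnd ℂ) ((smoothDMulti α g : Cn n → ℂ) x)

theorem pairingFunctional_monomial (f g : SmoothFn n) (x : Cn n) (α : RealIdx n →₀ ℕ) :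
    pairingFunctional f g x (monomial α 1) =
      (smoothDMulti α f : Cn n → ℂ) x * (starRingEnd ℂ) ((smoothDMulti α g : Cn n → ℂ) x) := by
  rw [pairingFunctional, ← congrFun (coe_basisMonomials (RealIdx n) ℂ) α, Module.Basis.constr_basis]

theorem pairingFunctional_X_mul (f g : SmoothFn n) (x : Cn n) (i : RealIdx n)
    (p : MvPolynomial (RealIdx n) ℂ) :
    pairingFunctional f g x (X i * p) = pairingFunctional (smoothD i f) (smoothD i g) x p := by
  have hD : ∀ (α : RealIdx n →₀ ℕ) (k : SmoothFn n),
      smoothDMulti (α + Finsupp.single i 1 : RealIdx n →₀ ℕ) k = smoothDMulti α (smoothD i k) := by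
    intro α k
    rw [Finsupp.coe_add, Finsupp.single_eq_pi_single, smoothDMulti_add_single]
    rfl
  suffices h : pairingFunctional f g x ∘ₗ LinearMap.mulLeft ℂ (X i) =
      pairingFunctional (smoothD i f) (smoothD i g) x from LinearMap.congr_fun h p
  refine (basisMonomials (RealIdx n) ℂ).ext fun α => ?_
  simp only [coe_basisMonomials, LinearMap.comp_apply, LinearMap.mulLeft_apply, X, monomial_mul,
    one_mul, pairingFunctional_monomial]
  rw [add_comm, hD, hD]

theorem jetPairing_eq_pairingFunctional (t : ℕ) (f g : SmoothFn n) (x : Cn n) :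
    jetPairing t f g x = pairingFunctional f g x ((∑ i, X i) ^ t) := by
  induction t generalizing f g with
  | zero =>
    rw [pow_zero, ← C_1, C_apply, pairingFunctional_monomial, Finsupp.coe_zero, smoothDMulti_zero]
    rfl
  | succ t ih =>
    rw [pow_succ', Finset.sum_mul, map_sum]
    simp only [pairingFunctional_X_mul, ← ih, jetPairing]

theorem jetPairing_eq_sum (t : ℕ) (f g : SmoothFn n) (x : Cn n) :
    jetPairing t f g x = ∑ α ∈ Finset.piAntidiag (Finset.univ : Finset (RealIdx n)) t,
      (gammaCoeff α : ℂ) * ((smoothDMulti α f : Cn n → ℂ) x *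
        (starRingEnd ℂ) ((smoothDMulti α g : Cn n → ℂ) x)) := by
  rw [jetPairing_eq_pairingFunctional, Finset.sum_pow_eq_sum_piAntidiag, map_sum]
  refine Finset.sum_congr rfl fun α _ => ?_
  have hmonomial : ∏ i, (X i : MvPolynomial (RealIdx n) ℂ) ^ α i =
      monomial (Finsupp.equivFunOnFinite.symm α) 1 := by
    rw [monomial_eq, C_1, one_mul, Finsupp.prod_fintype _ _ fun i => pow_zero _]
    rfl
  rw [hmonomial, ← nsmul_eq_mul, map_nsmul, pairingFunctional_monomial, nsmul_eq_mul]
  rfl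

theorem sum_multiIdx_eq (s : ℕ) (F : (RealIdx n → ℕ) → ℂ) :
    ∑ α : MultiIdx n s, F α.1 = ∑ α ∈ Finset.piAntidiag (Finset.univ : Finset (RealIdx n)) s, F α +
      ∑ α : MultiIdx n s with ∑ i, α.1 i < s, F α.1 := by
  rw [← Finset.sum_filter_not_add_sum_filter _ fun α : MultiIdx n s => ∑ i, α.1 i < s]
  congr 1
  refine Finset.sum_bij (fun α _ => α.1) (fun α hα => ?_) (fun _ _ _ _ => Subtype.ext)
    (fun α hα => ?_) fun _ _ => rfl
  · simpa [Finset.mem_piAntidiag] using α.2.antisymm (not_lt.1 (Finset.mem_filter.1 hα).2)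
  · have hsum : ∑ i, α i = s := (Finset.mem_piAntidiag.1 hα).1
    exact ⟨⟨α, hsum.le⟩, by simp only [Finset.mem_filter, Finset.mem_univ, true_and, hsum,
      lt_irrefl, not_false_eq_true], rfl⟩

end Derivatives

section BoundedFunctionals

open scoped NNReal

variable {n : ℕ}

theorem contDiff_conj {f : Cn n → ℂ} (hf : ContDiff ℝ ∞ f) :
    ContDiff ℝ ∞ fun x => (starRingEnd ℂ) (f x) :=
  Complex.conjCLE.contDiff.comp hf

variable (Ω : SmoothlyBoundedDomain n)

theorem inner_toL2 (f g : SmoothFn n) :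
    inner ℂ (toL2 Ω g) (toL2 Ω f) =
      ∫ x in Ω.carrier, (f : Cn n → ℂ) x * (starRingEnd ℂ) ((g : Cn n → ℂ) x) := by
  rw [L2.inner_def]
  refine integral_congr_ae ?_
  filter_upwards [(memLp_smooth Ω f).coeFn_toLp, (memLp_smooth Ω g).coeFn_toLp] with x hf hg
  simp only [toL2, LinearMap.coe_mk, AddHom.coe_mk, hf, hg, RCLike.inner_apply]

/-- The `ℓ¹`-version of the Sobolev norm of order `s` on smooth functions. -/
def sobNorm (s : ℕ) (φ : SmoothFn n) : ℝ :=
  ∑ α : MultiIdx n s, ‖toL2 Ω (smoothDMulti α.1 φ)‖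

theorem norm_toL2_smoothDMulti_le {s : ℕ} {α : RealIdx n → ℕ} (hα : ∑ i, α i ≤ s)
    (φ : SmoothFn n) : ‖toL2 Ω (smoothDMulti α φ)‖ ≤ sobNorm Ω s φ := by
  have hle : ∀ β : MultiIdx n s, ‖toL2 Ω (smoothDMulti β.1 φ)‖ ≤ sobNorm Ω s φ := fun β =>
    Finset.single_le_sum (f := fun β : MultiIdx n s => ‖toL2 Ω (smoothDMulti β.1 φ)‖)
      (fun _ _ => norm_nonneg _) (Finset.mem_univ β)
  exact hle ⟨α, hα⟩

/-- The functionals on smooth functions that are bounded in the Sobolev norm of order `s`. They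
need not be linear. -/
def boundedFunctionals (s : ℕ) : Submodule ℂ (SmoothFn n → ℂ) where
  carrier := {ℓ | ∃ C : ℝ≥0, ∀ φ, ‖ℓ φ‖ ≤ C * sobNorm Ω s φ}
  zero_mem' := ⟨0, fun _ => by simp⟩
  add_mem' := by
    rintro ℓ ℓ' ⟨C, hC⟩ ⟨D, hD⟩
    refine ⟨C + D, fun φ => (norm_add_le _ _).trans ?_⟩
    rw [NNReal.coe_add, add_mul]
    exact add_le_add (hC φ) (hD φ)
  smul_mem' := by
    rintro c ℓ ⟨C, hC⟩
    refine ⟨‖c‖₊ * C, fun φ => ?_⟩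
    rw [Pi.smul_apply, norm_smul, NNReal.coe_mul, coe_nnnorm, mul_assoc]
    exact mul_le_mul_of_nonneg_left (hC φ) (norm_nonneg c)

variable {Ω}

theorem comp_smoothD_mem_boundedFunctionals {s : ℕ} {ℓ : SmoothFn n → ℂ}
    (hℓ : ℓ ∈ boundedFunctionals Ω s) (i : RealIdx n) :
    ℓ ∘ smoothD i ∈ boundedFunctionals Ω (s + 1) := by
  obtain ⟨C, hC⟩ := hℓ
  have hnorm : ∀ φ, sobNorm Ω s (smoothD i φ) ≤
      Fintype.card (MultiIdx n s) * sobNorm Ω (s + 1) φ := by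
    intro φ
    rw [← nsmul_eq_mul]
    refine Finset.sum_le_card_nsmul _ _ _ fun α _ => ?_
    rw [← Module.End.mul_apply, ← smoothDMulti_add_single]
    refine norm_toL2_smoothDMulti_le Ω ?_ φ
    simpa [Finset.sum_add_distrib] using α.2
  refine ⟨C * Fintype.card (MultiIdx n s), fun φ => (hC (smoothD i φ)).trans ?_⟩
  rw [NNReal.coe_mul, NNReal.coe_natCast, mul_assoc]
  exact mul_le_mul_of_nonneg_left (hnorm φ) C.2

theorem comp_smoothD_smodEq {s : ℕ} {ℓ ℓ' : SmoothFn n → ℂ}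
    (h : ℓ ≡ ℓ' [SMOD boundedFunctionals Ω s]) (i : RealIdx n) :
    ℓ ∘ smoothD i ≡ ℓ' ∘ smoothD i [SMOD boundedFunctionals Ω (s + 1)] :=
  SModEq.sub_mem.2 (comp_smoothD_mem_boundedFunctionals (SModEq.sub_mem.1 h) i)

theorem mem_iff_of_smodEq {s : ℕ} {ℓ ℓ' : SmoothFn n → ℂ}
    (h : ℓ ≡ ℓ' [SMOD boundedFunctionals Ω s]) :
    ℓ ∈ boundedFunctionals Ω s ↔ ℓ' ∈ boundedFunctionals Ω s := by
  rw [← SModEq.zero, ← SModEq.zero]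
  exact ⟨h.symm.trans, h.trans⟩

variable (Ω)

theorem integral_mul_smoothDMulti_mem_boundedFunctionals {s : ℕ} {h : Cn n → ℂ}
    (hh : ContDiff ℝ ∞ h) {α : RealIdx n → ℕ} (hα : ∑ i, α i ≤ s) :
    (fun φ => ∫ x in Ω.carrier, h x * (smoothDMulti α φ : Cn n → ℂ) x) ∈
      boundedFunctionals Ω s := by
  set g : SmoothFn n := ⟨fun x => (starRingEnd ℂ) (h x), contDiff_conj hh⟩
  refine ⟨‖toL2 Ω g‖₊, fun φ => ?_⟩
  have hinner : ∫ x in Ω.carrier, h x * (smoothDMulti α φ : Cn n → ℂ) x =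
      inner ℂ (toL2 Ω g) (toL2 Ω (smoothDMulti α φ)) := by
    simp only [inner_toL2, g, Complex.conj_conj, mul_comm]
  refine (congrArg norm hinner).trans_le ?_
  exact (norm_inner_le_norm _ _).trans
    (mul_le_mul_of_nonneg_left (norm_toL2_smoothDMulti_le Ω hα φ) (norm_nonneg _))

variable {Ω} (r : DefiningFunction Ω)

namespace DefiningFunction

theorem integral_tangential {c : RealIdx n → Cn n → ℂ} (hc : ∀ j, ContDiff ℝ ∞ (c j))
    (h0 : ∀ x ∈ frontier Ω.carrier, ∑ j, c j x * r.nu j x = 0) {u : Cn n → ℂ}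
    (hu : ContDiff ℝ ∞ u) :
    ∫ x in Ω.carrier, ∑ j, c j x * partialD j u x =
      -∫ x in Ω.carrier, (∑ j, partialD j (c j) x) * u x := by
  have hzero := r.integral_divergence_eq_zero (fun j => (hc j).mul hu) fun x hx => by
    simp only [mul_right_comm _ (u x), ← Finset.sum_mul, h0 x hx, zero_mul]
  simp only [partialD_mul _ (hc _) hu, Finset.sum_add_distrib, ← Finset.sum_mul] at hzero
  rw [integral_add] at hzero
  · exact (neg_eq_of_add_eq_zero_right hzero).symm
  · exact integrableOn_of_continuous Ω ((continuous_sum_partialD hc).mul hu.continuous)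
  · exact integrableOn_of_continuous Ω
      (contDiff_sum_mul _ hc fun j => contDiff_partialD j hu).continuous

theorem integral_tangential_mem_boundedFunctionals {c : RealIdx n → Cn n → ℂ}
    (hc : ∀ j, ContDiff ℝ ∞ (c j))
    (h0 : ∀ x ∈ frontier Ω.carrier, ∑ j, c j x * r.nu j x = 0) :
    (fun φ : SmoothFn n => ∫ x in Ω.carrier, ∑ j, c j x * partialD j φ x) ∈
      boundedFunctionals Ω 0 := by
  have hdiv : ContDiff ℝ ∞ fun x => ∑ j, partialD j (c j) x :=
    ContDiff.sum fun j _ => contDiff_partialD j (hc j)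
  convert neg_mem (integral_mul_smoothDMulti_mem_boundedFunctionals Ω hdiv (α := 0) (by simp))
    using 1
  funext φ
  rw [r.integral_tangential hc h0 (contDiff_coe φ), smoothDMulti_zero]
  rfl

/-- `∑ ν_{j₁} ⋯ ν_{j_k} D_{j₁} ⋯ D_{j_k} f`, the `k`-th derivative in the direction of the gradient
of the defining function with the gradient held fixed. -/
def normalPow : ℕ → SmoothFn n → Cn n → ℂ
  | 0, f => f
  | k + 1, f => fun x => ∑ j, r.nu j x * normalPow k (smoothD j f) x

theorem contDiff_normalPow (k : ℕ) (f : SmoothFn n) : ContDiff ℝ ∞ (r.normalPow k f) := by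
  induction k generalizing f with
  | zero => exact contDiff_coe f
  | succ k ih => exact contDiff_sum_mul _ r.contDiff_nu fun j => ih (smoothD j f)

/-- The functional `φ ↦ ∫_Ω h N^k φ`, where `N^k` stands for `normalPow`. -/
def normalFunctional (h : Cn n → ℂ) (k : ℕ) (φ : SmoothFn n) : ℂ :=
  ∫ x in Ω.carrier, h x * r.normalPow k φ x

theorem integrableOn_mul_normalPow {h : Cn n → ℂ} (hh : Continuous h) (k : ℕ) (φ : SmoothFn n) :
    IntegrableOn (fun x => h x * r.normalPow k φ x) Ω.carrier :=
  integrableOn_of_continuous Ω (hh.mul (r.contDiff_normalPow k φ).continuous)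

theorem normalFunctional_sum {ι : Type*} (t : Finset ι) {h : ι → Cn n → ℂ}
    (hh : ∀ j, Continuous (h j)) (k : ℕ) :
    r.normalFunctional (fun x => ∑ j ∈ t, h j x) k = ∑ j ∈ t, r.normalFunctional (h j) k := by
  funext φ
  simp only [normalFunctional, Finset.sum_apply, Finset.sum_mul]
  exact integral_finsetSum _ fun j _ => r.integrableOn_mul_normalPow (hh j) k φ

theorem normalFunctional_add {h h' : Cn n → ℂ} (hh : Continuous h) (hh' : Continuous h') (k : ℕ) :
    r.normalFunctional (fun x => h x + h' x) k =
      r.normalFunctional h k + r.normalFunctional h' k := by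
  funext φ
  simp only [normalFunctional, Pi.add_apply, add_mul]
  exact integral_add (r.integrableOn_mul_normalPow hh k φ) (r.integrableOn_mul_normalPow hh' k φ)

theorem normalFunctional_const_mul (c : ℂ) (h : Cn n → ℂ) (k : ℕ) :
    r.normalFunctional (fun x => c * h x) k = c • r.normalFunctional h k := by
  funext φ
  simp only [normalFunctional, Pi.smul_apply, mul_assoc, integral_const_mul, smul_eq_mul]

theorem normalFunctional_succ {h : Cn n → ℂ} (hh : Continuous h) (k : ℕ) :
    r.normalFunctional h (k + 1) =
      ∑ j, r.normalFunctional (fun x => h x * r.nu j x) k ∘ smoothD j := by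
  funext φ
  simp only [normalFunctional, normalPow, Finset.sum_apply, Function.comp_apply, Finset.mul_sum,
    ← mul_assoc]
  exact integral_finsetSum _ fun j _ =>
    r.integrableOn_mul_normalPow (hh.mul (r.contDiff_nu j).continuous) k (smoothD j φ)

theorem normalFunctional_zero_comp_smoothD {h : Cn n → ℂ} (hh : ContDiff ℝ ∞ h) (i : RealIdx n) :
    r.normalFunctional h 0 ∘ smoothD i ≡ r.normalFunctional (fun x => h x * r.nu i x) 1
      [SMOD boundedFunctionals Ω 0] := by
  set c : RealIdx n → Cn n → ℂ := fun j x => h x * ((if j = i then 1 else 0) - r.nu i x * r.nu j x)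
  have hc : ∀ j, ContDiff ℝ ∞ (c j) := fun j =>
    hh.mul (contDiff_const.sub ((r.contDiff_nu i).mul (r.contDiff_nu j)))
  have hsum : ∀ (w : RealIdx n → ℂ) (x : Cn n), ∑ j, c j x * w j =
      h x * w i - h x * r.nu i x * ∑ j, r.nu j x * w j := by
    intro w x
    simp only [c, mul_assoc, sub_mul, ← Finset.mul_sum, Finset.sum_sub_distrib, ite_mul, zero_mul,
      one_mul, Finset.sum_ite_eq', Finset.mem_univ, if_true, mul_sub]
  rw [SModEq.sub_mem]
  convert r.integral_tangential_mem_boundedFunctionals hc fun x hx => ?_ using 1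
  · funext φ
    simp only [hsum]
    exact (integral_sub (integrableOn_of_continuous Ω (hh.mul (contDiff_coe _)).continuous)
      (r.integrableOn_mul_normalPow (hh.mul (r.contDiff_nu i)).continuous 1 φ)).symm
  · rw [hsum, r.sum_nu_mul_self (r.frontier_subset hx)]
    ring

theorem normalFunctional_comp_smoothD (k : ℕ) {h : Cn n → ℂ} (hh : ContDiff ℝ ∞ h)
    (i : RealIdx n) :
    r.normalFunctional h k ∘ smoothD i ≡ r.normalFunctional (fun x => h x * r.nu i x) (k + 1)
      [SMOD boundedFunctionals Ω k] := by
  induction k generalizing h with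
  | zero => exact r.normalFunctional_zero_comp_smoothD hh i
  | succ k ih =>
    have hcomm : r.normalFunctional h (k + 1) ∘ smoothD i =
        ∑ j, (r.normalFunctional (fun x => h x * r.nu j x) k ∘ smoothD i) ∘ smoothD j := by
      funext φ
      simp only [r.normalFunctional_succ hh.continuous, Function.comp_apply, Finset.sum_apply]
      exact Finset.sum_congr rfl fun j _ =>
        congrArg _ (LinearMap.congr_fun (commute_smoothD j i).eq φ)
    rw [hcomm, r.normalFunctional_succ (hh.mul (r.contDiff_nu i)).continuous]
    refine SModEq.sum fun j _ => comp_smoothD_smodEq ?_ j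
    simpa only [mul_right_comm] using ih (hh.mul (r.contDiff_nu j))

theorem normalFunctional_mem_boundedFunctionals (k : ℕ) {h : Cn n → ℂ} (hh : ContDiff ℝ ∞ h)
    (h0 : ∀ x ∈ frontier Ω.carrier, h x = 0) :
    r.normalFunctional h (k + 1) ∈ boundedFunctionals Ω k := by
  induction k generalizing h with
  | zero =>
    convert r.integral_tangential_mem_boundedFunctionals (fun j => hh.mul (r.contDiff_nu j))
      (fun x hx => by simp [h0 x hx]) using 1
    funext φ
    simp only [normalFunctional, normalPow, Finset.mul_sum, mul_assoc]
    rfl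
  | succ k ih =>
    rw [r.normalFunctional_succ hh.continuous]
    exact sum_mem fun j _ => comp_smoothD_mem_boundedFunctionals
      (ih (hh.mul (r.contDiff_nu j)) fun x hx => by simp [h0 x hx]) j

end DefiningFunction

variable (Ω)

theorem continuous_jetPairing (t : ℕ) (f g : SmoothFn n) : Continuous (jetPairing t f g) := by
  induction t generalizing f g with
  | zero => exact ((contDiff_coe f).mul (contDiff_conj (contDiff_coe g))).continuous
  | succ t ih => exact continuous_finsetSum _ fun i _ => ih _ _

/-- The part of the Sobolev inner product with `ψ` that contains the derivatives of order `t`. -/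
def jetFunctional (t : ℕ) (ψ φ : SmoothFn n) : ℂ :=
  ∫ x in Ω.carrier, jetPairing t φ ψ x

theorem jetFunctional_succ (t : ℕ) (ψ : SmoothFn n) :
    jetFunctional Ω (t + 1) ψ = ∑ j, jetFunctional Ω t (smoothD j ψ) ∘ smoothD j := by
  funext φ
  simp only [jetFunctional, jetPairing, Finset.sum_apply, Function.comp_apply]
  exact integral_finsetSum _ fun j _ => integrableOn_of_continuous Ω (continuous_jetPairing _ _ _)

variable {Ω} in
theorem DefiningFunction.jetFunctional_comp_smoothD (t : ℕ) (ψ : SmoothFn n) (i : RealIdx n) :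
    jetFunctional Ω t ψ ∘ smoothD i ≡
      r.normalFunctional (fun x => (starRingEnd ℂ) (r.normalPow t ψ x) * r.nu i x) (t + 1)
      [SMOD boundedFunctionals Ω t] := by
  induction t generalizing ψ i with
  | zero =>
    have hzero : jetFunctional Ω 0 ψ =
        r.normalFunctional (fun x => (starRingEnd ℂ) (r.normalPow 0 ψ x)) 0 := by
      funext φ
      simp only [jetFunctional, jetPairing, normalFunctional, normalPow, mul_comm]
    rw [hzero]
    exact r.normalFunctional_comp_smoothD 0 (contDiff_conj (contDiff_coe ψ)) i
  | succ t ih =>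
    have hconj : (fun x => (starRingEnd ℂ) (r.normalPow (t + 1) ψ x)) = fun x =>
        ∑ j, (starRingEnd ℂ) (r.normalPow t (smoothD j ψ) x) * r.nu j x := by
      funext x
      simp only [normalPow, map_sum, map_mul, conj_nu, mul_comm]
    calc jetFunctional Ω (t + 1) ψ ∘ smoothD i
        = (∑ j, jetFunctional Ω t (smoothD j ψ) ∘ smoothD j) ∘ smoothD i := by
          rw [jetFunctional_succ]
      _ ≡ (∑ j, r.normalFunctional
            (fun x => (starRingEnd ℂ) (r.normalPow t (smoothD j ψ) x) * r.nu j x) (t + 1)) ∘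
            smoothD i [SMOD boundedFunctionals Ω (t + 1)] :=
          comp_smoothD_smodEq (SModEq.sum fun j _ => ih (smoothD j ψ) j) i
      _ = r.normalFunctional (fun x => (starRingEnd ℂ) (r.normalPow (t + 1) ψ x)) (t + 1) ∘
            smoothD i := by
          rw [hconj, normalFunctional_sum]
          exact fun j => ((contDiff_conj (r.contDiff_normalPow t _)).mul
            (r.contDiff_nu j)).continuous
      _ ≡ _ [SMOD boundedFunctionals Ω (t + 1)] :=
          r.normalFunctional_comp_smoothD (t + 1) (contDiff_conj (r.contDiff_normalPow _ ψ)) i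

/-- The Sobolev inner product of order `s` on smooth functions, as a linear functional of the
factor that is not conjugated. -/
def sobInner (s : ℕ) (ψ : SmoothFn n) : SmoothFn n →ₗ[ℂ] ℂ :=
  ∑ α : MultiIdx n s, (gammaCoeff α.1 : ℂ) •
    ((innerₛₗ ℂ (toL2 Ω (smoothDMulti α.1 ψ))).comp (toL2 Ω ∘ₗ smoothDMulti α.1))

theorem sobInner_apply (s : ℕ) (ψ φ : SmoothFn n) :
    sobInner Ω s ψ φ = ∑ α : MultiIdx n s, (gammaCoeff α.1 : ℂ) *
      ∫ x in Ω.carrier, (smoothDMulti α.1 φ : Cn n → ℂ) x *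
        (starRingEnd ℂ) ((smoothDMulti α.1 ψ : Cn n → ℂ) x) := by
  simp [sobInner, inner_toL2]

theorem jetFunctional_eq_sum (t : ℕ) (ψ φ : SmoothFn n) :
    jetFunctional Ω t ψ φ = ∑ α ∈ Finset.piAntidiag (Finset.univ : Finset (RealIdx n)) t,
      (gammaCoeff α : ℂ) * ∫ x in Ω.carrier, (smoothDMulti α φ : Cn n → ℂ) x *
        (starRingEnd ℂ) ((smoothDMulti α ψ : Cn n → ℂ) x) := by
  simp only [jetFunctional, jetPairing_eq_sum, ← integral_const_mul]
  exact integral_finsetSum _ fun α _ => integrableOn_of_continuous Ω (continuous_const.mul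
    ((contDiff_coe _).mul (contDiff_conj (contDiff_coe _))).continuous)

theorem sobInner_comp_smoothD_smodEq_jetFunctional (s : ℕ) (ψ : SmoothFn n) (i : RealIdx n) :
    sobInner Ω s ψ ∘ smoothD i ≡ jetFunctional Ω s ψ ∘ smoothD i
      [SMOD boundedFunctionals Ω s] := by
  have hlower : ∑ α : MultiIdx n s with ∑ j, α.1 j < s, (gammaCoeff α.1 : ℂ) •
      (fun φ => ∫ x in Ω.carrier, (starRingEnd ℂ) ((smoothDMulti α.1 ψ : Cn n → ℂ) x) *
        (smoothDMulti (α.1 + Pi.single i 1) φ : Cn n → ℂ) x) ∈ boundedFunctionals Ω s := by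
    refine Submodule.sum_mem _ fun α hα => Submodule.smul_mem _ _
      (integral_mul_smoothDMulti_mem_boundedFunctionals Ω (contDiff_conj (contDiff_coe _)) ?_)
    simpa [Finset.sum_add_distrib] using Nat.succ_le_of_lt (Finset.mem_filter.1 hα).2
  rw [SModEq.sub_mem]
  convert hlower using 1
  funext φ
  simp only [Pi.sub_apply, Function.comp_apply, sobInner_apply, jetFunctional_eq_sum]
  rw [sum_multiIdx_eq s fun α => (gammaCoeff α : ℂ) *
    ∫ x in Ω.carrier, (smoothDMulti α (smoothD i φ) : Cn n → ℂ) x *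
      (starRingEnd ℂ) ((smoothDMulti α ψ : Cn n → ℂ) x), add_sub_cancel_left]
  simp only [Finset.sum_apply, Pi.smul_apply, smul_eq_mul, smoothDMulti_add_single,
    Module.End.mul_apply, mul_comm]

variable {Ω} in
theorem DefiningFunction.sobInner_comp_smoothD (s : ℕ) (ψ : SmoothFn n) (i : RealIdx n) :
    sobInner Ω s ψ ∘ smoothD i ≡
      r.normalFunctional (fun x => (starRingEnd ℂ) (r.normalPow s ψ x) * r.nu i x) (s + 1)
      [SMOD boundedFunctionals Ω s] :=
  (sobInner_comp_smoothD_smodEq_jetFunctional Ω s ψ i).trans (r.jetFunctional_comp_smoothD s ψ i)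

end BoundedFunctionals

section NormalDerivative

open Topology

variable {n : ℕ}

theorem contraction_congr {q : ℕ} {ψ ψ' : FormIdx n (q + 1) → Cn n → ℂ} {η η' : Fin n → Cn n → ℂ}
    {x : Cn n} (hψ : ∀ K, ψ K x = ψ' K x) (hη : ∀ k, η k x = η' k x) (I : FormIdx n q) :
    contraction ψ η I x = contraction ψ' η' I x := by
  simp only [contraction, hψ, hη]

theorem contDiff_contraction {q : ℕ} {ψ : FormIdx n (q + 1) → Cn n → ℂ} {η : Fin n → Cn n → ℂ}
    (hψ : ∀ K, ContDiff ℝ ∞ (ψ K)) (hη : ∀ k, ContDiff ℝ ∞ (η k)) (I : FormIdx n q) :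
    ContDiff ℝ ∞ (contraction ψ η I) :=
  ContDiff.sum fun k _ => ContDiff.sum fun K _ =>
    (contDiff_const.mul (hψ K)).mul (contDiff_conj (hη k))

theorem fderiv_contraction {q : ℕ} {ψ : FormIdx n (q + 1) → Cn n → ℂ} {η : Fin n → Cn n → ℂ}
    (hψ : ∀ K, ContDiff ℝ ∞ (ψ K)) (hη : ∀ k, ContDiff ℝ ∞ (η k)) {x v : Cn n}
    (hv : ∀ k, fderiv ℝ (η k) x v = 0) (I : FormIdx n q) :
    fderiv ℝ (contraction ψ η I) x v = contraction (fun K y => fderiv ℝ (ψ K) y v) η I x := by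
  have hderiv : HasFDerivAt (contraction ψ η I) _ x :=
    HasFDerivAt.fun_sum fun k _ => HasFDerivAt.fun_sum fun K _ =>
      ((((hψ K).differentiable (by simp) x).hasFDerivAt.const_mul (epsSign K k I : ℂ))).mul
        (Complex.conjCLE.hasFDerivAt.comp x ((hη k).differentiable (by simp) x).hasFDerivAt)
  rw [hderiv.fderiv]
  simp [contraction, hv, mul_comm]

namespace DefiningFunction

variable {Ω : SmoothlyBoundedDomain n} (r : DefiningFunction Ω)

theorem fderiv_nu_gradient {x : Cn n} (hx : x ∈ r.nhd) (j : RealIdx n) :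
    fderiv ℝ (r.nu j) x (gradient r.toFun x) = 0 := by
  have hunit : (fun y => ∑ i, r.nu i y * r.nu i y) =ᶠ[𝓝 x] fun _ => 1 :=
    Filter.eventually_of_mem (r.isOpen_nhd.mem_nhds hx) fun y hy => r.sum_nu_mul_self hy
  have hcomm : ∀ i, partialD j (r.nu i) = partialD i (r.nu j) := fun i =>
    partialD_comm j i r.contDiff_ofReal
  have hzero : partialD j (fun y => ∑ i, r.nu i y * r.nu i y) x = 0 := by
    rw [partialD, hunit.fderiv_eq, fderiv_fun_const, Pi.zero_apply, zero_apply]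
  simp only [partialD_sum _ _ fun i => (r.contDiff_nu i).mul (r.contDiff_nu i),
    partialD_mul _ (r.contDiff_nu _) (r.contDiff_nu _), hcomm, mul_comm (partialD _ _ _),
    ← two_mul, ← Finset.mul_sum, ← r.fderiv_gradient] at hzero
  simpa using hzero

theorem fderiv_normalPow_gradient {x : Cn n} (hx : x ∈ r.nhd) (k : ℕ) (f : SmoothFn n) :
    fderiv ℝ (r.normalPow k f) x (gradient r.toFun x) = r.normalPow (k + 1) f x := by
  induction k generalizing f with
  | zero => exact r.fderiv_gradient f x
  | succ k ih =>
    have hderiv : HasFDerivAt (r.normalPow (k + 1) f) _ x := HasFDerivAt.fun_sum fun j _ =>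
      ((r.contDiff_nu j).differentiable (by simp) x).hasFDerivAt.mul
        ((r.contDiff_normalPow k (smoothD j f)).differentiable (by simp) x).hasFDerivAt
    rw [hderiv.fderiv]
    simp only [FunLike.coe_sum, Finset.sum_apply, add_apply, smul_apply, r.fderiv_nu_gradient hx,
      ih, smul_eq_mul, mul_zero, add_zero, normalPow]

/-- The coefficients of `∂̄` of the defining function. -/
def dbarCoeff (k : Fin n) : Cn n → ℂ := wirtingerBar k fun x => (r.toFun x : ℂ)

theorem dbarCoeff_apply (k : Fin n) (x : Cn n) :
    r.dbarCoeff k x = (1 / 2 : ℂ) * (r.nu (Sum.inl k) x + Complex.I * r.nu (Sum.inr k) x) := rfl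

theorem contDiff_dbarCoeff (k : Fin n) : ContDiff ℝ ∞ (r.dbarCoeff k) :=
  contDiff_const.mul ((r.contDiff_nu _).add (contDiff_const.mul (r.contDiff_nu _)))

theorem fderiv_dbarCoeff_gradient {x : Cn n} (hx : x ∈ r.nhd) (k : Fin n) :
    fderiv ℝ (r.dbarCoeff k) x (gradient r.toFun x) = 0 := by
  have hnu := fun i => ((r.contDiff_nu i).differentiable (by simp) x).hasFDerivAt
  have hderiv : HasFDerivAt (r.dbarCoeff k) _ x :=
    ((hnu (Sum.inl k)).add ((hnu (Sum.inr k)).const_mul Complex.I)).const_mul (1 / 2 : ℂ)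
  rw [hderiv.fderiv]
  simp [r.fderiv_nu_gradient hx]

theorem signedDist_eventuallyEq {x : Cn n} (hx : x ∈ r.nhd) : signedDist Ω =ᶠ[𝓝 x] r.toFun :=
  Filter.eventually_of_mem (r.isOpen_nhd.mem_nhds hx) fun y hy => (r.eq_signedDist y hy).symm

theorem normalD_eq {f F : Cn n → ℂ} (hfF : Set.EqOn f F r.nhd) {x : Cn n} (hx : x ∈ r.nhd) :
    normalD Ω f x = fderiv ℝ F x (gradient r.toFun x) := by
  rw [normalD, gradient, (r.signedDist_eventuallyEq hx).fderiv_eq,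
    (hfF.eventuallyEq_of_mem (r.isOpen_nhd.mem_nhds hx)).fderiv_eq, gradient]

theorem dbarSignedDist_eq {x : Cn n} (hx : x ∈ r.nhd) (k : Fin n) :
    dbarSignedDist Ω k x = r.dbarCoeff k x := by
  have hcast : (fun y => (signedDist Ω y : ℂ)) =ᶠ[𝓝 x] fun y => (r.toFun y : ℂ) :=
    (r.signedDist_eventuallyEq hx).fun_comp (fun t : ℝ => (t : ℂ))
  simp only [dbarSignedDist, dbarCoeff, wirtingerBar, partialD, hcast.fderiv_eq]

/-- The contraction of the `s`-th normal derivative of a form with `∂̄` of the defining function. -/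
def normalTrace {q : ℕ} (s : ℕ) (ψ : SmoothForm n (q + 1)) : FormIdx n q → Cn n → ℂ :=
  contraction (fun K => r.normalPow s (ψ K)) r.dbarCoeff

theorem contDiff_normalTrace {q : ℕ} (s : ℕ) (ψ : SmoothForm n (q + 1)) (I : FormIdx n q) :
    ContDiff ℝ ∞ (r.normalTrace s ψ I) :=
  contDiff_contraction (fun K => r.contDiff_normalPow s (ψ K)) r.contDiff_dbarCoeff I

theorem iterate_normalD_contraction {q : ℕ} (s : ℕ) (ψ : SmoothForm n (q + 1))
    (I : FormIdx n q) :
    Set.EqOn ((normalD Ω)^[s] (contraction (fun K => (ψ K : Cn n → ℂ)) (dbarSignedDist Ω) I))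
      (r.normalTrace s ψ I) r.nhd := by
  induction s with
  | zero => exact fun x hx => contraction_congr (fun _ => rfl) (r.dbarSignedDist_eq hx) I
  | succ s ih =>
    intro x hx
    rw [Function.iterate_succ_apply', r.normalD_eq ih hx, normalTrace,
      fderiv_contraction (fun K => r.contDiff_normalPow s (ψ K)) r.contDiff_dbarCoeff
        (r.fderiv_dbarCoeff_gradient hx)]
    exact contraction_congr (fun K => r.fderiv_normalPow_gradient hx s (ψ K)) (fun _ => rfl) I

end DefiningFunction

end NormalDerivative

/-! ### Functions concentrated at the boundary -/

section Concentration

open Topology Filter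

theorem tendsto_inv_pow_succ_smul {E : Type*} [NormedAddCommGroup E] [NormedSpace ℂ E]
    {A B : ℕ → E} {k : ℕ} {l : E} (hA : Tendsto (fun m : ℕ => (m : ℂ)⁻¹ ^ k • A m) atTop (𝓝 l))
    (hB : Tendsto (fun m : ℕ => (m : ℂ)⁻¹ ^ (k + 1) • B m) atTop (𝓝 0)) :
    Tendsto (fun m : ℕ => (m : ℂ)⁻¹ ^ (k + 1) • ((m : ℂ) • A m + B m)) atTop (𝓝 l) := by
  refine (add_zero l ▸ hA.add hB).congr' ?_
  filter_upwards [eventually_ne_atTop 0] with m hm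
  rw [smul_add, smul_smul, pow_succ (m : ℂ)⁻¹ k, mul_assoc,
    inv_mul_cancel₀ (Nat.cast_ne_zero.2 hm), mul_one]

variable {n : ℕ}

/-- The product of two smooth functions. -/
def smoothMul {f : Cn n → ℂ} (hf : ContDiff ℝ ∞ f) (b : SmoothFn n) : SmoothFn n :=
  ⟨fun x => f x * (b : Cn n → ℂ) x, hf.mul (contDiff_coe b)⟩

variable {Ω : SmoothlyBoundedDomain n}

theorem tendsto_setIntegral_mul_zero {F : ℕ → Cn n → ℂ} (hF : ∀ m, Continuous (F m))
    (hle : ∀ m, ∀ x ∈ Ω.carrier, ‖F m x‖ ≤ 1)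
    (h0 : ∀ x ∈ Ω.carrier, Tendsto (fun m => F m x) atTop (𝓝 0)) {c : Cn n → ℂ}
    (hc : Continuous c) :
    Tendsto (fun m => ∫ x in Ω.carrier, F m x * c x) atTop (𝓝 0) := by
  rw [← integral_zero (Cn n) ℂ (μ := volume.restrict Ω.carrier)]
  refine tendsto_integral_of_dominated_convergence (fun x => ‖c x‖)
    (fun m => ((hF m).mul hc).aestronglyMeasurable) (integrableOn_of_continuous Ω hc.norm)
    (fun m => ?_) ?_
  · filter_upwards [ae_restrict_mem Ω.isOpen.measurableSet] with x hx
    rw [norm_mul]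
    exact mul_le_of_le_one_left (norm_nonneg _) (hle m x hx)
  · filter_upwards [ae_restrict_mem Ω.isOpen.measurableSet] with x hx
    simpa only [zero_mul] using (h0 x hx).mul_const (c x)

namespace DefiningFunction

variable (r : DefiningFunction Ω)

theorem isLinearMap_normalFunctional {h : Cn n → ℂ} (hh : Continuous h) (k : ℕ) :
    IsLinearMap ℂ (r.normalFunctional h k) := by
  induction k generalizing h with
  | zero =>
    refine ⟨fun f g => ?_, fun c f => ?_⟩
    · simp only [normalFunctional, normalPow, Submodule.coe_add, Pi.add_apply, mul_add]
      exact integral_add (r.integrableOn_mul_normalPow hh 0 f)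
        (r.integrableOn_mul_normalPow hh 0 g)
    · simp only [normalFunctional, normalPow, Submodule.coe_smul, Pi.smul_apply, smul_eq_mul,
        mul_left_comm _ c, integral_const_mul]
  | succ k ih =>
    have hlin := fun j => ih (hh.fun_mul (r.contDiff_nu j).continuous)
    rw [r.normalFunctional_succ hh]
    refine ⟨fun f g => ?_, fun c f => ?_⟩
    · simp only [Finset.sum_apply, Function.comp_apply, map_add, (hlin _).map_add,
        Finset.sum_add_distrib]
    · simp only [Finset.sum_apply, Function.comp_apply, map_smul, (hlin _).map_smul,
        Finset.smul_sum]

theorem boundaryIntegral_congr {f g : Cn n → ℂ} (hf : ContDiff ℝ ∞ f) (hg : ContDiff ℝ ∞ g)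
    (hfg : ∀ x ∈ frontier Ω.carrier, f x = g x) : r.boundaryIntegral f = r.boundaryIntegral g :=
  r.integral_divergence (fun i => hf.mul (r.contDiff_nu i)) hg fun x hx => by
    simp only [mul_assoc, ← Finset.mul_sum, r.sum_nu_mul_self (r.frontier_subset hx), mul_one,
      hfg x hx]

theorem sum_boundaryIntegral_mul_nu {f : Cn n → ℂ} (hf : ContDiff ℝ ∞ f) :
    ∑ j, r.boundaryIntegral (fun x => f x * r.nu j x * r.nu j x) = r.boundaryIntegral f := by
  have hV := fun i j : RealIdx n =>
    ((hf.mul (r.contDiff_nu j)).mul (r.contDiff_nu j)).mul (r.contDiff_nu i)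
  simp only [boundaryIntegral]
  rw [← integral_finsetSum _ fun j _ =>
    integrableOn_of_continuous Ω (continuous_sum_partialD fun i => hV i j)]
  simp only [Finset.sum_comm (s := Finset.univ (α := RealIdx n)), ← partialD_sum _ _ (hV _)]
  refine r.integral_divergence (fun i => ContDiff.sum fun j _ => hV i j) hf fun x hx => ?_
  have hν := r.sum_nu_mul_self (r.frontier_subset hx)
  have hsum : ∑ j, f x * r.nu j x * r.nu j x = f x := by
    simp only [mul_assoc, ← Finset.mul_sum, hν, mul_one]
  simp only [← Finset.sum_mul, hsum]

theorem normalFunctional_one {h : Cn n → ℂ} (hh : ContDiff ℝ ∞ h) (φ : SmoothFn n) :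
    r.normalFunctional h 1 φ = r.boundaryIntegral (fun x => h x * (φ : Cn n → ℂ) x) -
      ∫ x in Ω.carrier, (φ : Cn n → ℂ) x * ∑ j, partialD j (fun y => h y * r.nu j y) x := by
  have hhν := fun j => hh.mul (r.contDiff_nu j)
  rw [eq_sub_iff_add_eq, normalFunctional, boundaryIntegral,
    ← integral_add (r.integrableOn_mul_normalPow hh.continuous 1 φ) (integrableOn_of_continuous Ω
      ((contDiff_coe φ).continuous.fun_mul (continuous_sum_partialD hhν)))]
  simp only [mul_right_comm (h _), partialD_mul _ (hhν _) (contDiff_coe φ), normalPow,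
    Finset.mul_sum, ← Finset.sum_add_distrib]
  refine integral_congr_ae (ae_of_all _ fun x => Finset.sum_congr rfl fun j _ => ?_)
  change h x * (r.nu j x * partialD j φ x) + _ = _
  ring

/-- The exponential of a multiple of the defining function. For large `m` it is concentrated in a
layer of width `1 / m` along the boundary of `Ω`. -/
def layer (m : ℕ) (x : Cn n) : ℂ := Complex.exp (m * r.toFun x)

theorem contDiff_layer (m : ℕ) : ContDiff ℝ ∞ (r.layer m) :=
  (contDiff_const.mul r.contDiff_ofReal).cexp

theorem layer_of_mem_frontier (m : ℕ) {x : Cn n} (hx : x ∈ frontier Ω.carrier) :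
    r.layer m x = 1 := by
  rw [layer, (r.zero_iff x).1 hx, Complex.ofReal_zero, mul_zero, Complex.exp_zero]

theorem norm_layer (m : ℕ) (x : Cn n) : ‖r.layer m x‖ = Real.exp (m * r.toFun x) := by
  rw [layer, Complex.norm_exp]
  simp

theorem norm_layer_le_one (m : ℕ) {x : Cn n} (hx : x ∈ Ω.carrier) : ‖r.layer m x‖ ≤ 1 := by
  rw [norm_layer, Real.exp_le_one_iff]
  exact mul_nonpos_of_nonneg_of_nonpos m.cast_nonneg ((r.neg_iff x).1 hx).le

theorem tendsto_layer {x : Cn n} (hx : x ∈ Ω.carrier) :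
    Tendsto (fun m => r.layer m x) atTop (𝓝 0) := by
  rw [tendsto_zero_iff_norm_tendsto_zero]
  simp only [norm_layer]
  exact Real.tendsto_exp_atBot.comp
    (tendsto_natCast_atTop_atTop.atTop_mul_const_of_neg ((r.neg_iff x).1 hx))

theorem smoothD_smoothMul_layer (m : ℕ) (b : SmoothFn n) (i : RealIdx n) :
    smoothD i (smoothMul (r.contDiff_layer m) b) =
      (m : ℂ) • smoothMul (r.contDiff_layer m) (smoothMul (r.contDiff_nu i) b) +
        smoothMul (r.contDiff_layer m) (smoothD i b) := by
  ext x
  have hderiv : HasFDerivAt (r.layer m) _ x :=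
    ((r.contDiff_ofReal.differentiable (by simp) x).hasFDerivAt.const_mul (m : ℂ)).cexp
  have hlayer : partialD i (r.layer m) x = r.layer m x * (m * r.nu i x) := by
    rw [partialD, hderiv.fderiv]
    rfl
  change partialD i (fun y => r.layer m y * (b : Cn n → ℂ) y) x =
    m * (r.layer m x * (r.nu i x * (b : Cn n → ℂ) x)) + r.layer m x * partialD i b x
  rw [partialD_mul i (r.contDiff_layer m) (contDiff_coe b), hlayer]
  ring

theorem tendsto_inv_pow_smul_normalFunctional_layer {k s : ℕ} (hks : k ≤ s) {h : Cn n → ℂ}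
    (hh : Continuous h) (b : SmoothFn n) :
    Tendsto (fun m : ℕ =>
      (m : ℂ)⁻¹ ^ s • r.normalFunctional h k (smoothMul (r.contDiff_layer m) b)) atTop (𝓝 0) := by
  induction k generalizing s h b with
  | zero =>
    have hint : Tendsto (fun m => r.normalFunctional h 0 (smoothMul (r.contDiff_layer m) b)) atTop
        (𝓝 0) := by
      simpa only [normalFunctional, normalPow, smoothMul, mul_left_comm] using
        tendsto_setIntegral_mul_zero (fun m => (r.contDiff_layer m).continuous)
          (fun m x => r.norm_layer_le_one m) (fun x => r.tendsto_layer)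
          (hh.fun_mul (contDiff_coe b).continuous)
    simpa only [smul_zero] using ((tendsto_inv_atTop_nhds_zero_nat (𝕜 := ℂ)).pow s).smul hint
  | succ k ih =>
    obtain ⟨s, rfl⟩ := Nat.exists_eq_add_of_lt hks
    have hν := fun j => hh.fun_mul (r.contDiff_nu j).continuous
    simp only [r.normalFunctional_succ hh, Finset.sum_apply, Function.comp_apply, Finset.smul_sum,
      smoothD_smoothMul_layer, (r.isLinearMap_normalFunctional (hν _) k).map_add,
      (r.isLinearMap_normalFunctional (hν _) k).map_smul]
    rw [← Finset.sum_const_zero (s := Finset.univ (α := RealIdx n))]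
    exact tendsto_finsetSum _ fun j _ => tendsto_inv_pow_succ_smul
      (ih (Nat.le_add_right k s) (hν j) _) (ih (by omega) (hν j) _)

theorem tendsto_inv_pow_smul_normalFunctional_succ_layer (k : ℕ) {h : Cn n → ℂ}
    (hh : ContDiff ℝ ∞ h) (b : SmoothFn n) :
    Tendsto (fun m : ℕ =>
      (m : ℂ)⁻¹ ^ k • r.normalFunctional h (k + 1) (smoothMul (r.contDiff_layer m) b)) atTop
      (𝓝 (r.boundaryIntegral fun x => h x * (b : Cn n → ℂ) x)) := by
  have hν := fun j => hh.mul (r.contDiff_nu j)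
  induction k generalizing h b with
  | zero =>
    have hbdry : ∀ m, r.boundaryIntegral (fun x => h x * (r.layer m x * (b : Cn n → ℂ) x)) =
        r.boundaryIntegral fun x => h x * (b : Cn n → ℂ) x := fun m =>
      r.boundaryIntegral_congr (hh.mul ((r.contDiff_layer m).mul (contDiff_coe b)))
        (hh.mul (contDiff_coe b)) fun x hx => by rw [r.layer_of_mem_frontier m hx, one_mul]
    have hint := tendsto_setIntegral_mul_zero (fun m => (r.contDiff_layer m).continuous)
      (fun m x => r.norm_layer_le_one m) (fun x => r.tendsto_layer)
      ((contDiff_coe b).continuous.fun_mul (continuous_sum_partialD hν))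
    simpa only [zero_add, pow_zero, one_smul, r.normalFunctional_one hh, smoothMul, hbdry,
      mul_assoc, sub_zero] using hint.const_sub (r.boundaryIntegral _)
  | succ k ih =>
    simp only [r.normalFunctional_succ hh.continuous (k + 1), Finset.sum_apply,
      Function.comp_apply, Finset.smul_sum, smoothD_smoothMul_layer,
      (r.isLinearMap_normalFunctional (hν _).continuous (k + 1)).map_add,
      (r.isLinearMap_normalFunctional (hν _).continuous (k + 1)).map_smul]
    rw [← r.sum_boundaryIntegral_mul_nu (hh.mul (contDiff_coe b))]
    refine tendsto_finsetSum _ fun j _ => tendsto_inv_pow_succ_smul ?_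
      (r.tendsto_inv_pow_smul_normalFunctional_layer le_rfl (hν j).continuous _)
    convert ih (hν j) (smoothMul (r.contDiff_nu j) b) fun i => (hν j).mul (r.contDiff_nu i) using 4
    simp only [smoothMul]
    ring

theorem tendsto_toL2_layer (b : SmoothFn n) :
    Tendsto (fun m => toL2 Ω (smoothMul (r.contDiff_layer m) b)) atTop (𝓝 0) := by
  have hsq : Tendsto (fun m => ((‖toL2 Ω (smoothMul (r.contDiff_layer m) b)‖ : ℂ)) ^ 2) atTop
      (𝓝 0) := by
    convert tendsto_setIntegral_mul_zero (Ω := Ω)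
      (fun m => ((r.contDiff_layer m).mul (contDiff_conj (r.contDiff_layer m))).continuous)
      (fun m x hx => ?_) (fun x hx => ?_)
      ((contDiff_coe b).mul (contDiff_conj (contDiff_coe b))).continuous using 2 with m
    · refine (inner_self_eq_norm_sq_to_K (𝕜 := ℂ)
        (toL2 Ω (smoothMul (r.contDiff_layer m) b))).symm.trans ?_
      simp only [inner_toL2, smoothMul, map_mul, mul_mul_mul_comm]
    · rw [norm_mul, RCLike.norm_conj]
      exact mul_le_one₀ (r.norm_layer_le_one m hx) (norm_nonneg _) (r.norm_layer_le_one m hx)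
    · simpa using (r.tendsto_layer hx).mul ((Complex.continuous_conj.tendsto 0).comp
        (r.tendsto_layer hx))
  rw [tendsto_zero_iff_norm_tendsto_zero] at hsq ⊢
  simpa [Function.comp_def, Real.sqrt_sq] using (Real.continuous_sqrt.tendsto 0).comp hsq

theorem tendsto_inv_pow_smul_toL2_smoothDMulti_layer {s : ℕ} {α : RealIdx n → ℕ}
    (hα : ∑ i, α i ≤ s) (b : SmoothFn n) :
    Tendsto (fun m : ℕ =>
      (m : ℂ)⁻¹ ^ s • toL2 Ω (smoothDMulti α (smoothMul (r.contDiff_layer m) b))) atTop (𝓝 0) := by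
  induction α using multiIdx_induction generalizing s b with
  | zero =>
    simpa only [smoothDMulti_zero, Module.End.one_apply, smul_zero] using
      ((tendsto_inv_atTop_nhds_zero_nat (𝕜 := ℂ)).pow s).smul (r.tendsto_toL2_layer b)
  | add_single α i ih =>
    have hlt : ∑ j, α j < s := by simpa [Finset.sum_add_distrib, Nat.succ_le_iff] using hα
    obtain ⟨s, rfl⟩ := Nat.exists_eq_add_of_lt hlt
    simp only [smoothDMulti_add_single, Module.End.mul_apply, smoothD_smoothMul_layer, map_add,
      map_smul]
    exact tendsto_inv_pow_succ_smul (ih (Nat.le_add_right _ s) _) (ih (by omega) _)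

theorem tendsto_sobNorm_layer (s : ℕ) (b : SmoothFn n) :
    Tendsto (fun m : ℕ => sobNorm Ω s ((m : ℂ)⁻¹ ^ s • smoothMul (r.contDiff_layer m) b)) atTop
      (𝓝 0) := by
  simp only [sobNorm, map_smul]
  rw [← Finset.sum_const_zero (s := Finset.univ (α := MultiIdx n s))]
  exact tendsto_finsetSum _ fun α _ => tendsto_zero_iff_norm_tendsto_zero.1
    (r.tendsto_inv_pow_smul_toL2_smoothDMulti_layer α.2 b)

theorem boundaryIntegral_eq_zero_of_mem_boundedFunctionals {s : ℕ} {h : Cn n → ℂ}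
    (hh : ContDiff ℝ ∞ h) (hb : r.normalFunctional h (s + 1) ∈ boundedFunctionals Ω s)
    (b : SmoothFn n) : r.boundaryIntegral (fun x => h x * (b : Cn n → ℂ) x) = 0 := by
  obtain ⟨C, hC⟩ := hb
  refine tendsto_nhds_unique (r.tendsto_inv_pow_smul_normalFunctional_succ_layer s hh b) ?_
  simp only [← (r.isLinearMap_normalFunctional hh.continuous (s + 1)).map_smul]
  refine squeeze_zero_norm (fun m => hC _) ?_
  simpa only [mul_zero] using (r.tendsto_sobNorm_layer s b).const_mul (C : ℝ)

end DefiningFunction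

end Concentration

section TestFunctions

open Metric
open scoped Convolution Topology

theorem contDiff_div_of_tsupport {E 𝕜 : Type*} [NormedAddCommGroup E] [NormedSpace ℝ E]
    [NormedField 𝕜] [NormedAlgebra ℝ 𝕜] {m : WithTop ℕ∞} {f g : E → 𝕜} (hf : ContDiff ℝ m f)
    (hg : ContDiff ℝ m g) (h0 : ∀ x ∈ tsupport f, g x ≠ 0) : ContDiff ℝ m fun x => f x / g x := by
  refine contDiff_iff_contDiffAt.2 fun x => ?_
  by_cases hx : x ∈ tsupport f
  · simpa only [div_eq_mul_inv] using hf.contDiffAt.mul (hg.contDiffAt.fun_inv (h0 x hx))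
  · refine (contDiffAt_const (c := (0 : 𝕜))).congr_of_eventuallyEq ?_
    filter_upwards [(isClosed_tsupport f).isOpen_compl.mem_nhds hx] with y hy
    rw [image_eq_zero_of_notMem_tsupport hy, zero_div]

variable {E : Type*} [NormedAddCommGroup E] [NormedSpace ℝ E] [FiniteDimensional ℝ E]
  [MeasurableSpace E] [BorelSpace E] {μ : Measure E} [μ.IsAddHaarMeasure] {U : Set E}

theorem hasFDerivAt_convolution_indicator (hU : MeasurableSet U) {w : E → ℝ} (hw : ContDiff ℝ 1 w)
    (hc : HasCompactSupport w) {x : E}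
    (h0 : ∀ v, ∫ y in U, fderiv ℝ (fun z => w (x - z)) y v ∂μ = 0) :
    HasFDerivAt (w ⋆[ContinuousLinearMap.lsmul ℝ ℝ, μ] U.indicator fun _ => (1 : ℝ))
      (0 : E →L[ℝ] ℝ) x := by
  have hg : LocallyIntegrable (U.indicator fun _ => (1 : ℝ)) μ :=
    (locallyIntegrable_const 1).indicator hU
  have hfderiv : ∀ y v, fderiv ℝ (fun z => w (x - z)) y v = -fderiv ℝ w (x - y) v := by
    intro y v
    have h := ((hw.differentiable one_ne_zero (x - y)).hasFDerivAt.comp y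
      ((hasFDerivAt_id y).const_sub x)).fderiv
    simpa [Function.comp_def] using DFunLike.congr_fun h v
  rw [← convolution_flip]
  have hzero : ((U.indicator fun _ => (1 : ℝ)) ⋆[(ContinuousLinearMap.lsmul ℝ ℝ).flip.precompR E, μ]
      fderiv ℝ w) x = 0 := by
    ext v
    rw [convolution_precompR_apply _ hg (hc.fderiv ℝ) (hw.continuous_fderiv one_ne_zero),
      convolution_def, zero_apply, ← neg_eq_zero, ← integral_neg, ← h0 v,
      ← integral_indicator hU]
    refine integral_congr_ae (ae_of_all _ fun y => ?_)
    by_cases hy : y ∈ U <;> simp [hy, hfderiv]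
  rw [← hzero]
  exact hc.hasFDerivAt_convolution_right _ hg hw x

theorem hasFDerivAt_normed_convolution_indicator (hU : MeasurableSet U) {p : E} {δ : ℝ}
    (h0 : ∀ w : E → ℝ, ContDiff ℝ ∞ w → tsupport w ⊆ ball p δ →
      ∀ v, ∫ x in U, fderiv ℝ w x v ∂μ = 0)
    (φ : ContDiffBump (0 : E)) {z : E} (hz : z ∈ ball p (δ - φ.rOut)) :
    HasFDerivAt (φ.normed μ ⋆[ContinuousLinearMap.lsmul ℝ ℝ, μ] U.indicator fun _ => (1 : ℝ))
      (0 : E →L[ℝ] ℝ) z := by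
  have hsupp : tsupport (fun t => φ.normed μ (z - t)) ⊆ closedBall z φ.rOut := by
    refine closure_minimal (fun t ht => ?_) isClosed_closedBall
    have := subset_tsupport (φ.normed μ) ht
    rw [φ.tsupport_normed_eq, mem_closedBall_zero_iff] at this
    rwa [mem_closedBall', dist_eq_norm]
  exact hasFDerivAt_convolution_indicator hU φ.contDiff_normed φ.hasCompactSupport_normed
    (h0 _ (φ.contDiff_normed.comp (contDiff_const.sub contDiff_id))
      (hsupp.trans (closedBall_subset_ball' (by rw [mem_ball] at hz; linarith))))

theorem ball_subset_closure_of_setIntegral_fderiv_eq_zero (hU : IsOpen U) {p : E} {δ : ℝ}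
    (h0 : ∀ w : E → ℝ, ContDiff ℝ ∞ w → tsupport w ⊆ ball p δ →
      ∀ v, ∫ x in U, fderiv ℝ w x v ∂μ = 0)
    (hne : (ball p δ ∩ U).Nonempty) : ball p δ ⊆ closure U := by
  intro y hy
  by_contra hyU
  obtain ⟨x, hx, hxU⟩ := hne
  obtain ⟨ε, hε, hεx, hεy, hxp, hyp⟩ : ∃ ε > 0, ball x ε ⊆ U ∧ ball y ε ⊆ (closure U)ᶜ ∧
      x ∈ ball p (δ - ε) ∧ y ∈ ball p (δ - ε) := by
    obtain ⟨ε₁, hε₁, hx₁⟩ := isOpen_iff.1 hU x hxU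
    obtain ⟨ε₂, hε₂, hy₂⟩ := isOpen_iff.1 isClosed_closure.isOpen_compl y hyU
    rw [mem_ball] at hx hy
    refine ⟨min (min ε₁ ε₂) (min (δ - dist x p) (δ - dist y p) / 2), ?_, ?_, ?_, ?_, ?_⟩
    · have := sub_pos.2 hx
      have := sub_pos.2 hy
      positivity
    · exact (ball_subset_ball ((min_le_left _ _).trans (min_le_left _ _))).trans hx₁
    · exact (ball_subset_ball ((min_le_left _ _).trans (min_le_right _ _))).trans hy₂
    · rw [mem_ball]; grind
    · rw [mem_ball]; grind
  let φ : ContDiffBump (0 : E) := ⟨ε / 2, ε, half_pos hε, half_lt_self hε⟩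
  set u : E → ℝ :=
    φ.normed μ ⋆[ContinuousLinearMap.lsmul ℝ ℝ, μ] U.indicator fun _ => (1 : ℝ) with hu
  have hderiv : ∀ z ∈ ball p (δ - ε), HasFDerivAt u (0 : E →L[ℝ] ℝ) z :=
    fun _ => hasFDerivAt_normed_convolution_indicator hU.measurableSet h0 φ
  have hconst : u x = u y := isOpen_ball.is_const_of_fderiv_eq_zero
    (convex_ball p (δ - ε)).isPreconnected
    (fun z hz => (hderiv z hz).differentiableAt.differentiableWithinAt)
    (fun z hz => (hderiv z hz).fderiv) hxp hyp
  rw [hu, φ.normed_convolution_eq_right, φ.normed_convolution_eq_right] at hconst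
  · simp [hxU, Set.notMem_subset subset_closure hyU] at hconst
  · intro z hz
    rw [Set.indicator_of_notMem (Set.notMem_subset subset_closure (hεy hz)),
      Set.indicator_of_notMem (Set.notMem_subset subset_closure hyU)]
  · intro z hz
    rw [Set.indicator_of_mem (hεx hz), Set.indicator_of_mem hxU]

end TestFunctions

section Necessity

open Metric
open scoped Topology

variable {n : ℕ} {Ω : SmoothlyBoundedDomain n}

namespace DefiningFunction

variable (r : DefiningFunction Ω)

theorem integral_fderiv_eq_zero {h : Cn n → ℂ} (hh : ContDiff ℝ ∞ h)
    (hb : ∀ b : SmoothFn n, r.boundaryIntegral (fun x => h x * (b : Cn n → ℂ) x) = 0)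
    {w : Cn n → ℝ} (hw : ContDiff ℝ ∞ w) (hsupp : ∀ x ∈ tsupport w, h x ≠ 0) (v : Cn n) :
    ∫ x in Ω.carrier, fderiv ℝ w x v = 0 := by
  set f : Cn n → ℂ := fun x => w x with hf
  have hfs : ContDiff ℝ ∞ f := Complex.ofRealCLM.contDiff.comp hw
  have hfh : ContDiff ℝ ∞ fun x => f x / h x := by
    refine contDiff_div_of_tsupport hfs hh fun x hx => hsupp x ?_
    exact tsupport_comp_subset Complex.ofReal_zero w hx
  set V : RealIdx n → Cn n → ℂ := fun i x => (inner ℝ (dirVec i) v : ℝ) * f x with hV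
  let b : SmoothFn n := ⟨fun x => f x / h x * ∑ i, (inner ℝ (dirVec i) v : ℝ) * r.nu i x,
    hfh.mul (ContDiff.sum fun i _ => contDiff_const.mul (r.contDiff_nu i))⟩
  have hfb : ∀ x, h x * (f x / h x) = f x := by
    intro x
    by_cases hx : h x = 0
    · have := image_eq_zero_of_notMem_tsupport fun hxw => hsupp x hxw hx
      simp [hf, this]
    · exact mul_div_cancel₀ _ hx
  have hdiv : ∀ x, ∑ i, partialD i (V i) x = (fderiv ℝ w x v : ℝ) := by
    intro x
    have hfderiv : fderiv ℝ f x = Complex.ofRealCLM ∘L fderiv ℝ w x :=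
      (Complex.ofRealCLM.hasFDerivAt.comp x (hw.differentiable (by simp) x).hasFDerivAt).fderiv
    have hpartial : ∀ i, partialD i (V i) x =
        (inner ℝ (dirVec i) v : ℝ) * (fderiv ℝ w x (dirVec i) : ℝ) := by
      intro i
      rw [partialD, fderiv_const_mul (hfs.differentiable (by simp) x), hfderiv]
      rfl
    conv_rhs => rw [← sum_inner_dirVec_smul v]
    simp only [hpartial, map_sum, map_smul, smul_eq_mul, Complex.ofReal_sum, Complex.ofReal_mul]
  have hint := r.integral_divergence (V := V) (fun i => contDiff_const.mul hfs)
    (hh.mul (contDiff_coe b)) fun x _ => by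
      simp only [b, hV, ← mul_assoc, hfb, mul_right_comm _ (f x), ← Finset.sum_mul, mul_comm (f x)]
  simp only [hb, hdiv] at hint
  exact_mod_cast hint

theorem eq_zero_of_forall_boundaryIntegral_eq_zero {h : Cn n → ℂ} (hh : ContDiff ℝ ∞ h)
    (hb : ∀ b : SmoothFn n, r.boundaryIntegral (fun x => h x * (b : Cn n → ℂ) x) = 0)
    {p : Cn n} (hp : p ∈ frontier Ω.carrier) : h p = 0 := by
  by_contra hhp
  obtain ⟨δ, hδ, hball⟩ := Metric.mem_nhds_iff.1 (hh.continuous.continuousAt.eventually_ne hhp)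
  have hclosure : ball p δ ⊆ closure Ω.carrier :=
    ball_subset_closure_of_setIntegral_fderiv_eq_zero (μ := volume) Ω.isOpen
      (fun w hw hsupp => r.integral_fderiv_eq_zero hh hb hw fun x hx => hball (hsupp hx))
      (mem_closure_iff.1 (frontier_subset_closure hp) _ isOpen_ball (mem_ball_self hδ))
  have hmax : IsLocalMax r.toFun p := by
    filter_upwards [ball_mem_nhds p hδ] with x hx
    rw [(r.zero_iff p).1 hp]
    rcases (closure_eq_self_union_frontier Ω.carrier ▸ hclosure hx) with h | h
    · exact ((r.neg_iff x).1 h).le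
    · exact ((r.zero_iff x).1 h).le
  have hnorm := r.norm_gradient p (r.frontier_subset hp)
  rw [gradient, hmax.fderiv_eq_zero, map_zero, norm_zero] at hnorm
  exact zero_ne_one hnorm

theorem normalFunctional_mem_boundedFunctionals_iff (s : ℕ) {h : Cn n → ℂ}
    (hh : ContDiff ℝ ∞ h) :
    r.normalFunctional h (s + 1) ∈ boundedFunctionals Ω s ↔
      ∀ x ∈ frontier Ω.carrier, h x = 0 :=
  ⟨fun hb _ => r.eq_zero_of_forall_boundaryIntegral_eq_zero hh
    (r.boundaryIntegral_eq_zero_of_mem_boundedFunctionals hh hb),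
    r.normalFunctional_mem_boundedFunctionals s hh⟩

end DefiningFunction

end Necessity

/-! ### The domain of the adjoint -/

section AdjointClosure

open scoped NNReal

variable {𝕜 E F : Type*} [RCLike 𝕜] [NormedAddCommGroup E] [InnerProductSpace 𝕜 E]
  [NormedAddCommGroup F] [InnerProductSpace 𝕜 F]

theorem norm_inner_le_of_mem_graph_closure {T : E →ₗ.[𝕜] F} {y : F} {C : ℝ}
    (hC : ∀ z ∈ T.graph, ‖inner 𝕜 y z.2‖ ≤ C * ‖z.1‖) {z : E × F} (hz : z ∈ T.closure.graph) :
    ‖inner 𝕜 y z.2‖ ≤ C * ‖z.1‖ := by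
  by_cases hT : T.IsClosable
  · have hclosed : IsClosed {z : E × F | ‖inner 𝕜 y z.2‖ ≤ C * ‖z.1‖} :=
      isClosed_le (by fun_prop) (by fun_prop)
    rw [← hT.graph_closure_eq_closure_graph] at hz
    exact closure_minimal hC hclosed hz
  · rw [LinearPMap.closure_def' hT] at hz
    exact hC z hz

theorem mem_domain_adjoint_closure_iff [CompleteSpace E] (T : E →ₗ.[𝕜] F) (y : F) :
    y ∈ T.closure†.domain ↔ ∃ C : ℝ≥0, ∀ z ∈ T.graph, ‖inner 𝕜 y z.2‖ ≤ C * ‖z.1‖ := by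
  rw [LinearPMap.mem_adjoint_domain_iff]
  constructor
  · intro hc
    let S : T.closure.domain →L[𝕜] 𝕜 := ⟨(innerₛₗ 𝕜 y).comp T.closure.toFun, hc⟩
    refine ⟨‖S‖₊, fun z hz => ?_⟩
    obtain ⟨w, hw₁, hw₂⟩ := T.closure.mem_graph_iff.1
      (LinearPMap.le_graph_of_le T.le_closure hz)
    rw [← hw₁, ← hw₂]
    exact S.le_opNorm w
  · rintro ⟨C, hC⟩
    exact AddMonoidHomClass.continuous_of_bound _ (C : ℝ) fun w =>
      norm_inner_le_of_mem_graph_closure hC (T.closure.mem_graph w)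

end AdjointClosure

section AdjointDomain

open scoped NNReal

variable {n : ℕ} (Ω : SmoothlyBoundedDomain n) (s : ℕ) {q : ℕ}

theorem norm_jet_apply (φ : SmoothForm n q) (J : FormIdx n q) (α : MultiIdx n s) :
    ‖jet Ω s q φ (J, α)‖ = √(gammaCoeff α.1) * ‖toL2 Ω (smoothDMulti α.1 (φ J))‖ := by
  have hjet : jet Ω s q φ (J, α) = (√(gammaCoeff α.1) : ℂ) • toL2 Ω (smoothDMulti α.1 (φ J)) := rfl
  rw [hjet, norm_smul, Complex.norm_real, Real.norm_of_nonneg (Real.sqrt_nonneg _)]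

theorem sobNorm_le_norm_jet (φ : SmoothForm n q) (J : FormIdx n q) :
    sobNorm Ω s (φ J) ≤ Fintype.card (MultiIdx n s) * ‖jet Ω s q φ‖ := by
  have hle : ∀ α : MultiIdx n s, ‖toL2 Ω (smoothDMulti α.1 (φ J))‖ ≤ ‖jet Ω s q φ‖ := by
    intro α
    have hγ : 1 ≤ √(gammaCoeff α.1 : ℝ) := Real.one_le_sqrt.2 (by
      exact_mod_cast Nat.multinomial_pos _ _)
    calc ‖toL2 Ω (smoothDMulti α.1 (φ J))‖ ≤ ‖jet Ω s q φ (J, α)‖ := by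
          rw [norm_jet_apply]
          exact le_mul_of_one_le_left (norm_nonneg _) hγ
      _ ≤ ‖jet Ω s q φ‖ := PiLp.norm_apply_le _ _
  calc sobNorm Ω s (φ J) ≤ Finset.univ.card (α := MultiIdx n s) • ‖jet Ω s q φ‖ :=
        Finset.sum_le_card_nsmul _ _ _ fun α _ => hle α
    _ = _ := nsmul_eq_mul _ _

theorem norm_jet_single_le (J : FormIdx n q) (f : SmoothFn n) :
    ‖jet Ω s q (Pi.single J f)‖ ≤ (∑ α : MultiIdx n s, √(gammaCoeff α.1)) * sobNorm Ω s f := by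
  have hoff : ∀ J' ≠ J, ∑ α, ‖jet Ω s q (Pi.single J f) (J', α)‖ = 0 := fun J' hJ' =>
    Finset.sum_eq_zero fun α _ => by simp [norm_jet_apply, Pi.single_eq_of_ne hJ']
  calc ‖jet Ω s q (Pi.single J f)‖ ≤ ∑ p, ‖jet Ω s q (Pi.single J f) p‖ := by
        rw [PiLp.norm_eq_of_L2, Real.sqrt_le_left (Finset.sum_nonneg fun _ _ => norm_nonneg _)]
        exact Finset.sum_sq_le_sq_sum_of_nonneg fun _ _ => norm_nonneg _
    _ = ∑ α, ‖jet Ω s q (Pi.single J f) (J, α)‖ := by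
        rw [Fintype.sum_prod_type, Fintype.sum_eq_single J hoff]
    _ ≤ (∑ α : MultiIdx n s, √(gammaCoeff α.1)) * sobNorm Ω s f := by
        rw [Finset.sum_mul]
        refine Finset.sum_le_sum fun α _ => ?_
        rw [norm_jet_apply, Pi.single_eq_same]
        exact mul_le_mul_of_nonneg_left (norm_toL2_smoothDMulti_le Ω α.2 f) (Real.sqrt_nonneg _)

/-- The part of `⟨∂̄φ, ψ⟩_s` that comes from the coefficient `φ_J`. -/
def dbarPairing (ψ : SmoothForm n (q + 1)) (J : FormIdx n q) : SmoothFn n →ₗ[ℂ] ℂ :=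
  ∑ k : Fin n, ∑ K : FormIdx n (q + 1),
    (epsSign K k J : ℂ) • (sobInner Ω s (ψ K) ∘ₗ smoothWirtingerBar k)

theorem inner_toSobolev_smoothDbar (ψ : SmoothForm n (q + 1)) (φ : SmoothForm n q) :
    inner ℂ (toSobolev Ω s (q + 1) ψ) (toSobolev Ω s (q + 1) (smoothDbar n q φ)) =
      ∑ J, dbarPairing Ω s ψ J (φ J) := by
  have hinner : inner ℂ (toSobolev Ω s (q + 1) ψ) (toSobolev Ω s (q + 1) (smoothDbar n q φ)) =
      ∑ K, sobInner Ω s (ψ K) (smoothDbar n q φ K) := by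
    simp only [sobInner_apply]
    exact inner_jet Ω s (q + 1) _ ψ
  rw [hinner]
  simp only [smoothDbar, dbarPairing, LinearMap.pi_apply, LinearMap.sum_apply,
    LinearMap.smul_apply, LinearMap.comp_apply, LinearMap.proj_apply, map_sum, map_smul]
  rw [Finset.sum_comm, Finset.sum_comm (s := (Finset.univ : Finset (FormIdx n q)))]
  exact Finset.sum_congr rfl fun k _ => Finset.sum_comm

theorem toSobolev_mem_domain_iff (ψ : SmoothForm n (q + 1)) :
    toSobolev Ω s (q + 1) ψ ∈ (dbarAdjoint Ω s q).domain ↔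
      ∀ J, ⇑(dbarPairing Ω s ψ J) ∈ boundedFunctionals Ω s := by
  have hdomain : toSobolev Ω s (q + 1) ψ ∈ (dbarAdjoint Ω s q).domain ↔
      ∃ C : ℝ≥0, ∀ φ : SmoothForm n q, ‖∑ J, dbarPairing Ω s ψ J (φ J)‖ ≤ C * ‖jet Ω s q φ‖ := by
    rw [dbarAdjoint, dbar, mem_domain_adjoint_closure_iff, dbarSmooth_graph, dbarGraph]
    simp only [← inner_toSobolev_smoothDbar]
    exact exists_congr fun C => Set.forall_mem_range
  rw [hdomain]
  constructor
  · rintro ⟨C, hC⟩ J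
    refine ⟨C * ∑ α : MultiIdx n s, NNReal.sqrt (gammaCoeff α.1), fun f => ?_⟩
    calc ‖dbarPairing Ω s ψ J f‖ =
        ‖∑ J', dbarPairing Ω s ψ J' ((Pi.single J f : SmoothForm n q) J')‖ := by
          rw [Fintype.sum_eq_single J fun J' hJ' => by rw [Pi.single_eq_of_ne hJ', map_zero],
            Pi.single_eq_same]
      _ ≤ C * ‖jet Ω s q (Pi.single J f)‖ := hC _
      _ ≤ C * ((∑ α : MultiIdx n s, √(gammaCoeff α.1)) * sobNorm Ω s f) :=
          mul_le_mul_of_nonneg_left (norm_jet_single_le Ω s J f) C.2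
      _ = _ := by push_cast; ring
  · intro hb
    choose C hC using hb
    refine ⟨∑ J, C J * Fintype.card (MultiIdx n s), fun φ => ?_⟩
    push_cast
    rw [Finset.sum_mul]
    refine norm_sum_le_of_le _ fun J _ => ?_
    rw [mul_assoc]
    exact (hC J (φ J)).trans
      (mul_le_mul_of_nonneg_left (sobNorm_le_norm_jet Ω s φ J) (C J).2)

namespace DefiningFunction

variable {Ω : SmoothlyBoundedDomain n} (r : DefiningFunction Ω)

theorem sobInner_comp_smoothWirtingerBar (ψ : SmoothFn n) (k : Fin n) :
    sobInner Ω s ψ ∘ smoothWirtingerBar k ≡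
      r.normalFunctional (fun x => (starRingEnd ℂ) (r.normalPow s ψ x) * r.dbarCoeff k x) (s + 1)
      [SMOD boundedFunctionals Ω s] := by
  have hcont : ∀ i, Continuous fun x => (starRingEnd ℂ) (r.normalPow s ψ x) * r.nu i x := fun i =>
    ((contDiff_conj (r.contDiff_normalPow s ψ)).mul (r.contDiff_nu i)).continuous
  have hsplit : sobInner Ω s ψ ∘ smoothWirtingerBar k = (1 / 2 : ℂ) •
      (sobInner Ω s ψ ∘ smoothD (Sum.inl k) +
        Complex.I • (sobInner Ω s ψ ∘ smoothD (Sum.inr k))) := by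
    funext φ
    simp only [smoothWirtingerBar, Function.comp_apply, LinearMap.smul_apply, LinearMap.add_apply,
      map_smul, map_add, Pi.smul_apply, Pi.add_apply]
  have hcoeff : (fun x => (starRingEnd ℂ) (r.normalPow s ψ x) * r.dbarCoeff k x) = fun x =>
      (1 / 2 : ℂ) * ((starRingEnd ℂ) (r.normalPow s ψ x) * r.nu (Sum.inl k) x +
        Complex.I * ((starRingEnd ℂ) (r.normalPow s ψ x) * r.nu (Sum.inr k) x)) := by
    funext x
    rw [r.dbarCoeff_apply]
    ring
  rw [hsplit, hcoeff, normalFunctional_const_mul,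
    r.normalFunctional_add (hcont _) (continuous_const.fun_mul (hcont _)),
    normalFunctional_const_mul]
  exact ((r.sobInner_comp_smoothD s ψ _).add ((r.sobInner_comp_smoothD s ψ _).smul _)).smul _

theorem dbarPairing_smodEq (ψ : SmoothForm n (q + 1)) (J : FormIdx n q) :
    dbarPairing Ω s ψ J ≡
      r.normalFunctional (fun x => (starRingEnd ℂ) (r.normalTrace s ψ J x)) (s + 1)
      [SMOD boundedFunctionals Ω s] := by
  have hcont : ∀ k K, Continuous fun x =>
      (starRingEnd ℂ) (r.normalPow s (ψ K) x) * r.dbarCoeff k x := fun k K =>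
    ((contDiff_conj (r.contDiff_normalPow s (ψ K))).mul (r.contDiff_dbarCoeff k)).continuous
  have hpairing : ⇑(dbarPairing Ω s ψ J) = ∑ k : Fin n, ∑ K : FormIdx n (q + 1),
      (epsSign K k J : ℂ) • (sobInner Ω s (ψ K) ∘ smoothWirtingerBar k) := by
    funext φ
    simp only [dbarPairing, LinearMap.sum_apply, LinearMap.smul_apply, LinearMap.comp_apply,
      Finset.sum_apply, Pi.smul_apply, Function.comp_apply]
  have htrace : (fun x => (starRingEnd ℂ) (r.normalTrace s ψ J x)) = fun x =>
      ∑ k : Fin n, ∑ K : FormIdx n (q + 1), (epsSign K k J : ℂ) *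
        ((starRingEnd ℂ) (r.normalPow s (ψ K) x) * r.dbarCoeff k x) := by
    funext x
    simp only [normalTrace, contraction, map_sum, map_mul, map_intCast, Complex.conj_conj,
      mul_assoc]
  rw [hpairing, htrace, r.normalFunctional_sum _ fun k =>
    continuous_finsetSum _ fun K _ => continuous_const.fun_mul (hcont k K)]
  refine SModEq.sum fun k _ => ?_
  rw [r.normalFunctional_sum _ fun K => continuous_const.fun_mul (hcont k K)]
  refine SModEq.sum fun K _ => ?_
  rw [normalFunctional_const_mul]
  exact (r.sobInner_comp_smoothWirtingerBar s (ψ K) k).smul _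

end DefiningFunction

end AdjointDomain

end DbarSobolev

end

theorem proposition3p1 (n s q : ℕ) (Ω : DbarSobolev.SmoothlyBoundedDomain n)
    (ψ : DbarSobolev.SmoothForm n (q + 1)) :
    DbarSobolev.toSobolev Ω s (q + 1) ψ ∈ (DbarSobolev.dbarAdjoint Ω s q).domain ↔
      ∀ I : DbarSobolev.FormIdx n q, ∀ x ∈ frontier Ω.carrier,
        (DbarSobolev.normalD Ω)^[s]
          (DbarSobolev.contraction (fun K => (ψ K : DbarSobolev.Cn n → ℂ))
            (DbarSobolev.dbarSignedDist Ω) I) x = 0 := by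
  obtain ⟨r⟩ := DbarSobolev.nonempty_definingFunction Ω
  rw [DbarSobolev.toSobolev_mem_domain_iff]
  refine forall_congr' fun I => ?_
  rw [DbarSobolev.mem_iff_of_smodEq (r.dbarPairing_smodEq s ψ I),
    r.normalFunctional_mem_boundedFunctionals_iff s
      (DbarSobolev.contDiff_conj (r.contDiff_normalTrace s ψ I))]
  refine forall₂_congr fun x hx => ?_
  rw [map_eq_zero, r.iterate_normalD_contraction s ψ I (r.frontier_subset hx)]
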